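/- **Setting.** For a finite-dimensional real vector space $V$ let $\Lambda^{p,q}(V)=\bigwedge^pV^*\otimes\bigwedge^qV^*$, viewed as multilinear functionals $\varphi(X_1,\dots,X_p;Y_1,\dots,Y_q)$ alternating in the $X$'s and in the $Y$'s. Let $s\colon\Lambda^{p,q}\to\Lambda^{p+1,q-1}$ and $s^*\colon\Lambda^{p,q}\to\Lambda^{p-1,q+1}$ be $$(s\varphi)(X_1,\dots,X_{p+1};Y_1,\dots,Y_{q-1})=\sum_{a=1}^{p+1}(-1)^{a-1}\varphi(X_1,\dots,\widehat{X_a},\dots,X_{p+1};X_a,Y_1,\dots,Y_{q-1}),$$ $$(s^*\varphi)(X_1,\dots,X_{p-1};Y_1,\dots,Y_{q+1})=\sum_{a=1}^{q+1}(-1)^{a-1}\varphi(Y_a,X_1,\dots,X_{p-1};Y_1,\dots,\widehat{Y_a},\dots,Y_{q+1}),$$ and let $\Lambda^{p,q}_m(V)$ be the eigenspace of $s^*s$ on $\Lambda^{p,q}(V)$ for the eigenvalue $m(m+p-q+1)$ if $m\ge0$, and $0$ if $m<0$. A $(p,q)$-form on a manifold is a field of elements of $\Lambda^{p,q}$ of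 its tangent spaces. Let $T^n=\{\lambda\in\mathbb R^{n+1}:\lambda_i\ge0,\ \sum_i\lambda_i=1\}$. Let $\mathring{\mathcal P}_r\Lambda^{p,q}_m(T^n)$ be the space of $(p,q)$-forms on $T^n$ with polynomial coefficients of degree at most $r$, with values in $\Lambda^{p,q}_m$, and with vanishing trace: at every point of each facet $T^n\cap\{\lambda_i=0\}$ the form vanishes on vectors tangent to that facet. Let $\mathcal H_r\Lambda^{p,q}_m(\mathbb R^{n+1})$ be the space of $(p,q)$-forms on $\mathbb R^{n+1}$ whose coefficients are homogeneous polynomials of degree $r$ and whose values lie in $\Lambda^{p,q}_m$, and let $\mathring{\mathcal H}_r\Lambda^{p,q}_m(\mathbb R^{n+1})$ be the subspace of forms whose pullback to every coordinate hyperplane $\{\lambda_i=0\}$ vanishes. A form on $\mathbb R^{n+1}$ is an extension of its pullback under $T^n\hookrightarrow\mathbb R^{n+1}$. Let $\Phi\colon\mathbb R^{n+1}\to\mathbb R^{n+1}$, $\Phi(u_0,\dots,u_n)=(u_0^2,\dots,u_n^2)$, let $u_N=u_0u_1\cdots u_n$ and $\nu=\sum_iu_i\,du_i$. Let $\star$ be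 the Hodge star of $\mathbb R^{n+1}$, and let $\circledast_{\mathbb R^{n+1}}(\alpha\otimes\beta)=\star\alpha\otimes\star\beta$ and $\circledast_{S^n}(\alpha\otimes\beta)=\star(\nu\wedge\alpha)\otimes\star(\nu\wedge\beta)$. Let $d_L$ and $d_R$ be the exterior derivatives in the left and the right factor, $d_L(f\,du^I\otimes du^J)=(df\wedge du^I)\otimes du^J$ and $d_R(f\,du^I\otimes du^J)=du^I\otimes(df\wedge du^J)$. **Theorem.** Let $n,p,q,r\ge0$ and $m$ be integers and let $\bar\varphi\in\mathring{\mathcal P}_r\Lambda^{p,q}_m(T^n)$ be nonzero. Assume that we are not in the case $r=0$ and $m=q$. Put $k=p+q$ and $C=(2r+p+m+1)(2r+q-m)$. Then $C\ne0$, and $\bar\varphi$ has an extension $\varphi'\in\mathring{\mathcal H}_r\Lambda^{p,q}_m(\mathbb R^{n+1})$ such that, for every extension $\varphi\in\mathcal H_r\Lambda^{p,q}_m(\mathbb R^{n+1})$ of $\bar\varphi$, $$\varphi'=(-1)^kC^{-1}(\Phi^*)^{-1}\,u_N\,\circledast_{\mathbb R^{n+1}}^{-1}\,d_Ld_R\bigl(u_N^{-1}\circledast_{S^n}\Phi^*\varphi\bigr).$$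 Here all the inverses exist and are unique: $\circledast_{S^n}\Phi^*\varphi$ is $u_N$ times a unique form with polynomial coefficients, $\circledast_{\mathbb R^{n+1}}$ has a unique preimage of the form it is inverted on, and $\varphi'$ is the unique form with polynomial coefficients whose pullback under $\Phi$ is $(-1)^kC^{-1}u_N\circledast_{\mathbb R^{n+1}}^{-1}d_Ld_R(u_N^{-1}\circledast_{S^n}\Phi^*\varphi)$. In particular, $\varphi'$ depends only on $\bar\varphi$ and not on the extension $\varphi$. -/

import Mathlib

noncomputable section

namespace DoubleForm

/-! ### Double multicovectors -/

/-- Alternating `p`-linear maps on `V` with values in `F`; `Alt V ℝ p` is the space of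
`p`-covectors on `V`. Continuity is automatic in finite dimension. -/
abbrev Alt (V F : Type*) [NormedAddCommGroup V] [NormedSpace ℝ V]
    [NormedAddCommGroup F] [NormedSpace ℝ F] (p : ℕ) : Type _ :=
  V [⋀^Fin p]→L[ℝ] F

/-- `(p,q)`-covectors on `V`: functionals `φ(X₁,…,X_p; Y₁,…,Y_q)`, alternating in the `X`'s and
alternating in the `Y`'s, evaluated as `φ X Y`. -/
abbrev DCov (V : Type*) [NormedAddCommGroup V] [NormedSpace ℝ V] (p q : ℕ) : Type _ :=
  Alt V (Alt V ℝ q) p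

section Covectors

variable {V W : Type*} [NormedAddCommGroup V] [NormedSpace ℝ V]
  [NormedAddCommGroup W] [NormedSpace ℝ W] {p q p' q' : ℕ}

/-- The simple tensor `α ⊗ β`. -/
def tmul (α : Alt V ℝ p) (β : Alt V ℝ q) : DCov V p q :=
  (ContinuousLinearMap.toSpanSingleton ℝ β).compContinuousAlternatingMap α

/-- The transposition `τ`, `(τ φ)(Y; X) = φ(X; Y)`. -/
def transpose : DCov V p q →ₗ[ℝ] DCov V q p where
  toFun φ := AlternatingMap.mkContinuousAlternating
    { toFun := fun Y =>
        ((ContinuousAlternatingMap.apply ℝ V ℝ Y).compContinuousAlternatingMap φ).toAlternatingMap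
      map_update_add' := by intro _ Y i y y'; ext X; simp
      map_update_smul' := by intro _ Y i c y; ext X; simp
      map_eq_zero_of_eq' := by
        intro Y i j h hij
        ext X
        exact (φ X).map_eq_zero_of_eq Y h hij }
    ‖φ‖
    (fun Y X => by
      refine ((φ X).le_opNorm Y).trans ?_
      rw [mul_right_comm]
      exact mul_le_mul_of_nonneg_right (φ.le_opNorm X)
        (Finset.prod_nonneg fun _ _ => norm_nonneg _))
  map_add' _ _ := rfl
  map_smul' _ _ := rfl

@[simp] theorem transpose_apply (φ : DCov V p q) (Y : Fin q → V) (X : Fin p → V) :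
    transpose φ Y X = φ X Y := rfl

/-- Contraction `x ⌟ β`, inserting `x` into the first slot of `β`. -/
def contract (q : ℕ) : V →L[ℝ] Alt V ℝ (q + 1) →L[ℝ] Alt V ℝ q :=
  (ContinuousAlternatingMap.curryLeftLI (𝕜 := ℝ) (E := V) (F := ℝ)
    (n := q)).toContinuousLinearMap.flip

/-- For a linear family `c x : F → G`, the linear map `x ↦ c x ∘ φ`. -/
def postcompFamily {V F G : Type*} [NormedAddCommGroup V] [NormedSpace ℝ V]
    [NormedAddCommGroup F] [NormedSpace ℝ F] [NormedAddCommGroup G] [NormedSpace ℝ G] {p : ℕ}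
    (c : V →L[ℝ] F →L[ℝ] G) : Alt V F p →ₗ[ℝ] (V →L[ℝ] Alt V G p) where
  toFun φ := ((ContinuousLinearMap.compContinuousAlternatingMapCLM ℝ V F G (Fin p)).comp c).flip φ
  map_add' φ ψ := map_add _ φ ψ
  map_smul' t φ := map_smul _ t φ

/-- The linear map `φ ↦ (x ↦ ((X; Y) ↦ φ(X; x, Y)))`. -/
def insertRight (V : Type*) [NormedAddCommGroup V] [NormedSpace ℝ V] (p q : ℕ) :
    DCov V p (q + 1) →ₗ[ℝ] (V →L[ℝ] DCov V p q) :=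
  postcompFamily (contract q)

/-- The Bianchi sum `s : Λ^{p,q+1} → Λ^{p+1,q}`; see `bianchi_apply` for the explicit formula. -/
def bianchi : DCov V p (q + 1) →ₗ[ℝ] DCov V (p + 1) q :=
  (ContinuousAlternatingMap.alternatizeUncurryFinCLM ℝ V (Alt V ℝ q)
    (n := p)).toLinearMap ∘ₗ insertRight V p q

/-- `(sφ)(X₁,…,X_{p+1}; Y₁,…) = ∑ₐ (-1)^{a-1} φ(X₁,…,X̂ₐ,…,X_{p+1}; Xₐ, Y₁,…)`. -/
theorem bianchi_apply (φ : DCov V p (q + 1)) (X : Fin (p + 1) → V) (Y : Fin q → V) :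
    bianchi φ X Y = ∑ a : Fin (p + 1), (-1 : ℝ) ^ (a : ℕ) *
      φ (a.removeNth X) (Matrix.vecCons (X a) Y) := by
  have h : bianchi φ X = ∑ a : Fin (p + 1), (-1 : ℤ) ^ (a : ℕ) •
      insertRight V p q φ (X a) (a.removeNth X) :=
    ContinuousAlternatingMap.alternatizeUncurryFin_apply _ _
  have h2 : bianchi φ X Y = ∑ a : Fin (p + 1),
      ((-1 : ℤ) ^ (a : ℕ) • insertRight V p q φ (X a) (a.removeNth X)) Y := by
    rw [h]
    exact map_sum (ContinuousAlternatingMap.apply ℝ V ℝ Y) _ _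
  rw [h2]
  refine Finset.sum_congr rfl fun a _ => ?_
  have h3 : insertRight V p q φ (X a) (a.removeNth X) Y
      = φ (a.removeNth X) (Matrix.vecCons (X a) Y) := rfl
  rw [← h3, ContinuousAlternatingMap.smul_apply, zsmul_eq_mul]
  push_cast
  rfl

/-- The dual operator `s* : Λ^{p+1,q} → Λ^{p,q+1}`, with the roles of the two factors exchanged;
see `bianchiStar_apply` for the explicit formula. -/
def bianchiStar : DCov V (p + 1) q →ₗ[ℝ] DCov V p (q + 1) :=
  transpose ∘ₗ bianchi ∘ₗ transpose

/-- `(s*φ)(X₁,…; Y₁,…,Y_{q+1}) = ∑ₐ (-1)^{a-1} φ(Yₐ, X₁,…; Y₁,…,Ŷₐ,…,Y_{q+1})`. -/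
theorem bianchiStar_apply (φ : DCov V (p + 1) q) (X : Fin p → V) (Y : Fin (q + 1) → V) :
    bianchiStar φ X Y = ∑ a : Fin (q + 1), (-1 : ℝ) ^ (a : ℕ) *
      φ (Matrix.vecCons (Y a) X) (a.removeNth Y) := by
  simp [bianchiStar, bianchi_apply]

/-- The operator `s* s` on `Λ^{p,q}`; on `Λ^{p,0}` it is zero because `Λ^{p+1,-1} = 0`. -/
def sStarS (V : Type*) [NormedAddCommGroup V] [NormedSpace ℝ V] (p : ℕ) :
    (q : ℕ) → Module.End ℝ (DCov V p q)
  | 0 => 0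
  | _ + 1 => bianchiStar ∘ₗ bianchi

/-- The summand `Λ^{p,q}_m`: for `m ≥ 0` the eigenspace of `s* s` for the eigenvalue
`m (m + p - q + 1)`, and zero for `m < 0`. -/
def summand (V : Type*) [NormedAddCommGroup V] [NormedSpace ℝ V] (p q : ℕ) (m : ℤ) :
    Submodule ℝ (DCov V p q) :=
  if 0 ≤ m then
    LinearMap.eqLocus (sStarS V p q) (((m : ℝ) * (m + p - q + 1)) • LinearMap.id)
  else ⊥

/-- Pullback of a `(p,q)`-covector along a linear map: `(A^*φ)(X; Y) = φ(AX; AY)`. -/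
def pull (A : W →L[ℝ] V) (φ : DCov V p q) : DCov W p q :=
  (ContinuousAlternatingMap.compContinuousLinearMapCLM A).compContinuousAlternatingMap
    (φ.compContinuousLinearMap A)

@[simp] theorem pull_apply (A : W →L[ℝ] V) (φ : DCov V p q) (X : Fin p → W) (Y : Fin q → W) :
    pull A φ X Y = φ (fun a => A (X a)) (fun b => A (Y b)) := rfl

/-- The operator `A ⊗ B` on `(p,q)`-covectors, `α ⊗ β ↦ Aα ⊗ Bβ`; see `tensorMap_tmul`. -/
def tensorMap (A : Alt V ℝ p →L[ℝ] Alt V ℝ p')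
    (B : Alt V ℝ q →L[ℝ] Alt V ℝ q') (φ : DCov V p q) : DCov V p' q' :=
  transpose (A.compContinuousAlternatingMap
    (transpose (B.compContinuousAlternatingMap φ)))

theorem tensorMap_tmul (A : Alt V ℝ p →L[ℝ] Alt V ℝ p')
    (B : Alt V ℝ q →L[ℝ] Alt V ℝ q')
    (α : Alt V ℝ p) (β : Alt V ℝ q) :
    tensorMap A B (tmul α β) = tmul (A α) (B β) := by
  ext X Y
  have h : transpose (B.compContinuousAlternatingMap (tmul α β)) Y = (B β Y) • α := by
    ext Z
    simp [tmul, mul_comm]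
  change A (transpose (B.compContinuousAlternatingMap (tmul α β)) Y) X = _
  rw [h]
  simp [tmul, mul_comm]

/-- The wedge product `ℓ ∧ β` with a covector `ℓ`:
`(ℓ ∧ β)(Y₀,…,Y_q) = ∑ₐ (-1)^a ℓ(Yₐ) β(Y₀,…,Ŷₐ,…,Y_q)`. -/
def wedge (ℓ : V →L[ℝ] ℝ) (q : ℕ) : Alt V ℝ q →L[ℝ] Alt V ℝ (q + 1) :=
  ContinuousAlternatingMap.alternatizeUncurryFinCLM ℝ V ℝ ∘L
    ContinuousLinearMap.smulRightL ℝ V (Alt V ℝ q) ℓ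

end Covectors

/-! ### The Hodge star on `ℝ^N` -/

theorem append_update {E : Type*} {p j : ℕ} (x : Fin p → E) (Y : Fin j → E) (i : Fin j) (z : E) :
    Fin.append x (Function.update Y i z)
      = Function.update (Fin.append x Y) (Fin.natAdd p i) z := by
  funext a
  refine Fin.addCases (fun k => ?_) (fun k => ?_) a
  · rw [Fin.append_left, Function.update_of_ne, Fin.append_left]
    intro hk
    have := congrArg Fin.val hk
    simp at this
    omega
  · rw [Fin.append_right]
    by_cases hk : k = i
    · subst hk; simp
    · rw [Function.update_of_ne hk, Function.update_of_ne, Fin.append_right]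
      intro h'
      exact hk (Fin.natAdd_injective _ _ h')

/-- The covector `Y ↦ det (e_{f 1}, …, e_{f p}, Y₁, …, Y_j)` on `ℝ^N`, where `p + j = N`. -/
def volContract {N p j : ℕ} (h : p + j = N) (f : Fin p → Fin N) :
    Alt (Fin N → ℝ) ℝ j where
  toFun Y := Matrix.det (Matrix.of fun a : Fin N =>
    Fin.append (fun i => (Pi.single (f i) 1 : Fin N → ℝ)) Y (Fin.cast h.symm a))
  map_update_add' := by
    intro hdec Y i y y'
    obtain rfl := Subsingleton.elim hdec (instDecidableEqFin j)
    subst h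
    have := (Matrix.detRowAlternating (R := ℝ) (n := Fin (p + j))).map_update_add
      (Fin.append (fun i => (Pi.single (f i) 1 : Fin (p + j) → ℝ)) Y) (Fin.natAdd p i) y y'
    simp only [← append_update] at this
    exact this
  map_update_smul' := by
    intro hdec Y i c y
    obtain rfl := Subsingleton.elim hdec (instDecidableEqFin j)
    subst h
    have := (Matrix.detRowAlternating (R := ℝ) (n := Fin (p + j))).map_update_smul
      (Fin.append (fun i => (Pi.single (f i) 1 : Fin (p + j) → ℝ)) Y) (Fin.natAdd p i) c y
    simp only [← append_update] at this
    exact this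
  map_eq_zero_of_eq' := by
    intro Y i k hik hne
    subst h
    refine Matrix.det_zero_of_row_eq (i := Fin.natAdd p i) (j := Fin.natAdd p k) ?_ ?_
    · intro h'
      exact hne (Fin.natAdd_injective _ _ h')
    · funext b
      simp [hik]
  cont := by
    refine Continuous.matrix_det (continuous_matrix fun a b => ?_)
    subst h
    refine Fin.addCases (fun k => ?_) (fun k => ?_) a
    · simpa using continuous_const
    · simp only [Matrix.of_apply, Fin.cast_refl, id_eq, Fin.append_right]
      fun_prop

/-- The Hodge star `⋆ : Λ^p → Λ^j` of `ℝ^N` (`p + j = N`) for the standard inner product and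
orientation: `(⋆α)(Y) = (1/p!) ∑_f α(e_{f 1},…,e_{f p}) det(e_{f 1},…,e_{f p},Y₁,…,Y_j)`, so that
`⋆ e^I = ± e^{I^c}` with `e^I ∧ ⋆ e^I = e^1 ∧ ⋯ ∧ e^N`. (If `p + j ≠ N` it is set to zero.) -/
def hodge (N p j : ℕ) :
    Alt (Fin N → ℝ) ℝ p →L[ℝ] Alt (Fin N → ℝ) ℝ j :=
  if h : p + j = N then
    ((Nat.factorial p : ℝ)⁻¹) • ∑ f : Fin p → Fin N,
      (ContinuousAlternatingMap.apply ℝ (Fin N → ℝ) ℝ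
        (fun i => (Pi.single (f i) 1 : Fin N → ℝ))).smulRight (volContract h f)
  else 0

/-! ### Double forms on `ℝ^{n+1}` -/

/-- `(p,q)`-forms on `ℝ^{n+1}`, with coordinates indexed by `0, …, n`. -/
abbrev EForm (n p q : ℕ) : Type := (Fin (n + 1) → ℝ) → DCov (Fin (n + 1) → ℝ) p q

section EuclideanForms

variable {n p q : ℕ}

/-- The left exterior derivative `d_L`: the exterior derivative of `φ` viewed as a `p`-form with
values in the (fixed) vector space of `q`-covectors. -/
def dL (φ : EForm n p q) : EForm n (p + 1) q := extDeriv φ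

/-- The right exterior derivative `d_R`: as `d_L`, for the other factor. -/
def dR (φ : EForm n p q) : EForm n p (q + 1) :=
  fun x => transpose (extDeriv (fun y => transpose (φ y)) x)

/-- The double Hodge star `⊛ : Λ^{p,q} → Λ^{p',q'}` of `ℝ^{n+1}` (`p + p' = q + q' = n + 1`),
`⊛(α ⊗ β) = ⋆α ⊗ ⋆β`. -/
def ostar (p' q' : ℕ) (φ : EForm n p q) : EForm n p' q' :=
  fun x => tensorMap (hodge (n + 1) p p') (hodge (n + 1) q q') (φ x)

/-- The tautological covector field `ν = ∑ᵢ uᵢ duᵢ`. -/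
def nu (u : Fin (n + 1) → ℝ) : (Fin (n + 1) → ℝ) →L[ℝ] ℝ :=
  ∑ i, u i • ContinuousLinearMap.proj i

/-- The operator `⋆_{Sⁿ} α = ⋆ (ν ∧ α)`, at the point `u` of `ℝ^{n+1}`, from `p`-covectors to
`(n-p)`-covectors. -/
def starSphere (n p : ℕ) (u : Fin (n + 1) → ℝ) :
    Alt (Fin (n + 1) → ℝ) ℝ p →L[ℝ] Alt (Fin (n + 1) → ℝ) ℝ (n - p) :=
  hodge (n + 1) (p + 1) (n - p) ∘L wedge (nu u) p

/-- The operator `⊛_{Sⁿ}(α ⊗ β) = ⋆_{Sⁿ}α ⊗ ⋆_{Sⁿ}β` on double forms on `ℝ^{n+1}`. -/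
def ostarSphere (φ : EForm n p q) : EForm n (n - p) (n - q) :=
  fun u => tensorMap (starSphere n p u) (starSphere n q u) (φ u)

/-- The map `Φ(u₀,…,u_n) = (u₀²,…,u_n²)`. -/
def sqMap (n : ℕ) (u : Fin (n + 1) → ℝ) : Fin (n + 1) → ℝ := fun i => u i ^ 2

/-- The pullback `Φ^*` of double forms. -/
def pullSq (φ : EForm n p q) : EForm n p q :=
  fun u => pull (fderiv ℝ (sqMap n) u) (φ (sqMap n u))

/-- Multiplication of a double form by `u_N = u₀ u₁ ⋯ u_n`. -/
def mulUN (φ : EForm n p q) : EForm n p q := fun u => (∏ i, u i) • φ u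

/-- Double forms on `ℝ^{n+1}` with polynomial coefficients. -/
def PolyForm (n p q : ℕ) : Set (EForm n p q) :=
  {φ | ∀ X Y, ∃ f : MvPolynomial (Fin (n + 1)) ℝ, ∀ x, φ x X Y = MvPolynomial.eval x f}

/-- `H_r Λ^{p,q}_m(ℝ^{n+1})`: double forms whose coefficients are homogeneous polynomials of
degree `r` and whose values lie in the summand `Λ^{p,q}_m`. -/
def HomForm (n p q r : ℕ) (m : ℤ) : Set (EForm n p q) :=
  {φ | (∀ X Y, ∃ f : MvPolynomial (Fin (n + 1)) ℝ, f.IsHomogeneous r ∧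
      ∀ x, φ x X Y = MvPolynomial.eval x f) ∧
    ∀ x, φ x ∈ summand (Fin (n + 1) → ℝ) p q m}

/-- Vanishing trace on `ℝ^{n+1}`: the pullback to every coordinate hyperplane `{λᵢ = 0}` is zero,
that is, at points of the hyperplane `φ` vanishes on vectors tangent to the hyperplane. -/
def TraceFree (φ : EForm n p q) : Prop :=
  ∀ (i : Fin (n + 1)) (x : Fin (n + 1) → ℝ), x i = 0 →
    ∀ (X : Fin p → Fin (n + 1) → ℝ) (Y : Fin q → Fin (n + 1) → ℝ),
      (∀ a, X a i = 0) → (∀ b, Y b i = 0) → φ x X Y = 0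

/-- The subspace of `H_r Λ^{p,q}_m(ℝ^{n+1})` of forms with vanishing trace. -/
def HomFormTraceFree (n p q r : ℕ) (m : ℤ) : Set (EForm n p q) :=
  {φ | φ ∈ HomForm n p q r m ∧ TraceFree φ}

end EuclideanForms

/-! ### Double forms on the standard simplex -/

/-- The tangent space of the standard simplex `Tⁿ ⊆ ℝ^{n+1}`: vectors with coordinate sum `0`. -/
def tangent (n : ℕ) : Submodule ℝ (Fin (n + 1) → ℝ) where
  carrier := {v | ∑ i, v i = 0}
  add_mem' := by
    intro v w hv hw
    simp_all [Finset.sum_add_distrib]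
  zero_mem' := by simp
  smul_mem' := by
    intro c v hv
    simp_all [← Finset.mul_sum]

/-- `(p,q)`-forms on the standard simplex `Tⁿ`. -/
abbrev TForm (n p q : ℕ) : Type := stdSimplex ℝ (Fin (n + 1)) → DCov (tangent n) p q

section SimplexForms

variable {n p q : ℕ}

/-- `P_r Λ^{p,q}_m(Tⁿ)`: double forms on `Tⁿ` whose coefficients are polynomials of degree at most
`r` and whose values lie in the summand `Λ^{p,q}_m`. -/
def SimplexForm (n p q r : ℕ) (m : ℤ) : Set (TForm n p q) :=
  {φ | (∀ X Y, ∃ f : MvPolynomial (Fin (n + 1)) ℝ, f.totalDegree ≤ r ∧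
      ∀ x : stdSimplex ℝ (Fin (n + 1)), φ x X Y = MvPolynomial.eval (x : Fin (n + 1) → ℝ) f) ∧
    ∀ x, φ x ∈ summand (tangent n) p q m}

/-- Vanishing trace on `∂Tⁿ`: at every point of a facet `{λᵢ = 0}` of `Tⁿ`, the form vanishes on
vectors tangent to that facet. -/
def SimplexTraceFree (φ : TForm n p q) : Prop :=
  ∀ (i : Fin (n + 1)) (x : stdSimplex ℝ (Fin (n + 1))), (x : Fin (n + 1) → ℝ) i = 0 →
    ∀ (X : Fin p → tangent n) (Y : Fin q → tangent n),
      (∀ a, (X a : Fin (n + 1) → ℝ) i = 0) → (∀ b, (Y b : Fin (n + 1) → ℝ) i = 0) →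
        φ x X Y = 0

/-- The subspace of `P_r Λ^{p,q}_m(Tⁿ)` of forms with vanishing trace. -/
def SimplexFormTraceFree (n p q r : ℕ) (m : ℤ) : Set (TForm n p q) :=
  {φ | φ ∈ SimplexForm n p q r m ∧ SimplexTraceFree φ}

/-- The pullback of a double form on `ℝ^{n+1}` under the inclusion `Tⁿ ↪ ℝ^{n+1}`. -/
def restrict (φ : EForm n p q) : TForm n p q :=
  fun x => pull (tangent n).subtypeL (φ x)

/-- `φ` is an extension of `φbar`. -/
def IsExtension (φ : EForm n p q) (φbar : TForm n p q) : Prop := restrict φ = φbar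

end SimplexForms

/-! ### The extension formula -/

/-- `a = f⁻¹ b` for `f` considered on `S`: `a` is the unique element of `S` with `f a = b`. -/
def IsInverseValue {α β : Type*} (f : α → β) (S : Set α) (b : β) (a : α) : Prop :=
  a ∈ S ∧ f a = b ∧ ∀ a' ∈ S, f a' = b → a' = a

/-- The constant `C = (2r + p + m + 1)(2r + q - m)`. -/
def extConst (p q r : ℕ) (m : ℤ) : ℝ := (2 * r + p + m + 1) * (2 * r + q - m)

/-- The statement that every inverse in the following expression exists and is unique and that
`φ' = (-1)^k C⁻¹ (Φ^*)⁻¹ u_N ⊛⁻¹ d_L d_R (u_N⁻¹ ⊛_{Sⁿ} Φ^* φ)`, `k = p + q`. Here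
`η = u_N⁻¹ ⊛_{Sⁿ} Φ^* φ` is the quotient among forms with polynomial coefficients,
`χ = ⊛⁻¹ d_L d_R η`, and `(Φ^*)⁻¹` is taken among forms with polynomial coefficients. -/
def IsExtensionFormula {n p q : ℕ} (r : ℕ) (m : ℤ) (φ φ' : EForm n p q) : Prop :=
  ∃ (η : EForm n (n - p) (n - q)) (χ : EForm n p q),
    IsInverseValue mulUN (PolyForm n (n - p) (n - q)) (ostarSphere (pullSq φ)) η ∧
    IsInverseValue (ostar (n - p + 1) (n - q + 1)) Set.univ (dL (dR η)) χ ∧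
    IsInverseValue pullSq (PolyForm n p q)
      (((-1 : ℝ) ^ (p + q) * (extConst p q r m)⁻¹) • mulUN χ) φ'

end DoubleForm

end

noncomputable section

namespace DoubleForm

/-! ### Exterior multiplication and contraction of covectors -/

section AltOperators

variable {V : Type*} [NormedAddCommGroup V] [NormedSpace ℝ V] {p q : ℕ}

/-! A form on the simplex is the same thing as the product `dσ ∧ᴸ dσ ∧ᴿ φ` along the simplex, where
`σ = λ₀ + ⋯ + λ_n` and `φ` is any extension: exterior multiplication by `dσ` on both sides forgets
exactly what is invisible on `ker dσ`. If `φ` is homogeneous, scaling carries this to all of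
`ℝ^{n+1}`, so the monomial coefficients `b_a` of `dσ ∧ᴸ dσ ∧ᴿ φ` depend only on `φbar`. The
extension sought must be a linear function of the `b_a`.

That function is found by computing the formula on monomials. Since `ν = ½ Φ^*dσ`, the form `ν ∧ᴸ ν
∧ᴿ Φ^*φ` is `¼ Φ^*` of `∑ xᵃ b_a`. It vanishes where some `uᵢ = 0` because the trace vanishes
(`wedge₂_nu_eq_zero`), so it is divisible by `u_N`. The Hodge star turns exterior products into
contractions (`wedge_hodge`), so `⊛⁻¹ d_L d_R ⊛` is, up to `(-1)^{p+q}`, a double divergence.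
Differentiating the quotients of monomials by `u_N` (`pderiv_pderiv_quotient`, `exists_quotient`)
gives `Φ^*` of the form with coefficients `Aᴸ Aᴿ b_a`, where `Aᴸ = ∑ cᵢ (2aᵢ + N'ᵢ)` and `Aᴿ = ∑ c'ⱼ
(2aⱼ + Nⱼ)`. Here `cᵢ`, `c'ⱼ` contract the left and right factors with basis vectors, and `Nᵢ`,
`N'ᵢ` count occurrences of the index `i` in them.

It remains to study `E = Aᴸ Aᴿ (dσ ∧ᴸ)(dσ ∧ᴿ)` on constant double covectors. Exterior
multiplications and contractions are two commuting copies of the canonical anticommutation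
relations, with `s = ∑ wₖ c'ₖ` and `s* = ∑ w'ₖ cₖ`. In this algebra `E` commutes with `s` and `s*`,
hence preserves `Λ_m`. Moreover `sum_mul_extensionOp` shows that after multiplication by `dσ` on
both sides `E` acts as `(2r+q)(2r+p+1) - s*s`, which on `Λ_m` is the scalar `C`. Thus `C⁻¹E`
produces an extension. Its pullback under `Φ` is `u_N` times a polynomial form, which gives the
vanishing trace. Finally `C ≠ 0` because `Λ^{p,q}_m = 0` unless `0 ≤ m ≤ q`. -/

theorem contract_apply (x : V) (α : Alt V ℝ (q + 1)) (Y : Fin q → V) :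
    contract q x α Y = α (Matrix.vecCons x Y) := rfl

theorem wedge_apply (l : V →L[ℝ] ℝ) (α : Alt V ℝ q) (Y : Fin (q + 1) → V) :
    wedge l q α Y = ∑ a : Fin (q + 1), (-1 : ℝ) ^ (a : ℕ) * (l (Y a) * α (a.removeNth Y)) := by
  have h : wedge l q α Y = ∑ a : Fin (q + 1), (-1 : ℤ) ^ (a : ℕ) •
      (l (Y a) • α) (a.removeNth Y) :=
    ContinuousAlternatingMap.alternatizeUncurryFin_apply _ _
  rw [h]
  refine Finset.sum_congr rfl fun a _ => ?_
  rw [zsmul_eq_mul]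
  push_cast
  rfl

theorem removeNth_succ_vecCons {α : Type*} (b : Fin (q + 1)) (x : α) (Y : Fin (q + 1) → α) :
    (b.succ).removeNth (Matrix.vecCons x Y : Fin (q + 2) → α)
      = Matrix.vecCons x (b.removeNth Y) := by
  funext k
  refine Fin.cases ?_ (fun k => ?_) k
  · simp [Fin.removeNth]
  · simp [Fin.removeNth]

theorem alt_vecCons_removeNth (α : Alt V ℝ (q + 1)) (a : Fin (q + 1)) (x : V)
    (Y : Fin (q + 1) → V) (hx : Y a = x) :
    α (Matrix.vecCons x (a.removeNth Y)) = (-1 : ℝ) ^ (a : ℕ) * α Y := by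
  have h := AlternatingMap.map_insertNth α.toAlternatingMap a x (a.removeNth Y)
  rw [← hx, Fin.insertNth_self_removeNth] at h
  have h' : α Y = (-1 : ℤ) ^ (a : ℕ) • α (Matrix.vecCons (Y a) (a.removeNth Y)) := h
  rw [h', ← hx, zsmul_eq_mul]
  push_cast
  rw [← mul_assoc, ← pow_add, Even.neg_one_pow (by simp), one_mul]

theorem contract_wedge_zero (l : V →L[ℝ] ℝ) (x : V) (α : Alt V ℝ 0) :
    contract 0 x (wedge l 0 α) = l x • α := by
  ext Y
  rw [contract_apply, wedge_apply]
  simp [Subsingleton.elim _ Y]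

theorem contract_wedge (l : V →L[ℝ] ℝ) (x : V) (α : Alt V ℝ (q + 1)) :
    contract (q + 1) x (wedge l (q + 1) α) = l x • α - wedge l q (contract q x α) := by
  ext Y
  rw [contract_apply, wedge_apply, Fin.sum_univ_succ]
  have h0 : Fin.removeNth (0 : Fin (q + 2)) (Matrix.vecCons x Y : Fin (q + 2) → V) = Y := by
    funext k; simp [Fin.removeNth]
  simp only [removeNth_succ_vecCons, h0]
  simp only [Fin.val_zero, pow_zero, one_mul, Matrix.cons_val_zero, Fin.val_succ,
    Matrix.cons_val_succ, ContinuousAlternatingMap.sub_apply, ContinuousAlternatingMap.smul_apply,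
    smul_eq_mul, wedge_apply, contract_apply]
  rw [sub_eq_add_neg, ← Finset.sum_neg_distrib]
  congr 1
  exact Finset.sum_congr rfl fun a _ => by ring

theorem contract_self (x : V) (α : Alt V ℝ (q + 2)) :
    contract q x (contract (q + 1) x α) = 0 := by
  ext Y
  rw [contract_apply, contract_apply]
  exact α.map_eq_zero_of_eq _ (i := 0) (j := 1) rfl (by simp)

theorem contract_comm (x y : V) (α : Alt V ℝ (q + 2)) :
    contract q x (contract (q + 1) y α) = -contract q y (contract (q + 1) x α) := by
  have h := contract_self (x + y) α
  simp only [map_add, add_apply, contract_self] at h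
  rw [eq_neg_iff_add_eq_zero]
  simpa [add_comm] using h

theorem alt_ext_contract {α β : Alt V ℝ (q + 1)} (h : ∀ x, contract q x α = contract q x β) :
    α = β := by
  ext Y
  have := congrArg (fun γ : Alt V ℝ q => γ (Matrix.vecTail Y)) (h (Matrix.vecHead Y))
  simpa [contract_apply] using this

/-- An alternating form is determined by its contractions, and contraction is an antiderivation.
Contracting with an arbitrary vector reduces the identity to the degree below. -/
theorem wedge_wedge (l l' : V →L[ℝ] ℝ) : ∀ (q : ℕ) (α : Alt V ℝ q),
    wedge l (q + 1) (wedge l' q α) + wedge l' (q + 1) (wedge l q α) = 0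
  | 0, α => by
    refine alt_ext_contract fun x => ?_
    rw [map_add, contract_wedge, contract_wedge, contract_wedge_zero, contract_wedge_zero]
    simp
  | q + 1, α => by
    refine alt_ext_contract fun x => ?_
    have h := wedge_wedge l l' q (contract q x α)
    simp only [map_add, contract_wedge, map_sub, map_smul, map_zero]
    rw [← h]
    abel

/-- If `z ⌟ α = 0`, adding multiples of `z` to an argument does not change `α`. The slots are
treated one at a time, since contraction with the first argument preserves the hypothesis up to
sign. -/
theorem alt_proj_eq (l : V →L[ℝ] ℝ) (z : V) (hz : l z = 1) : ∀ (p : ℕ) (α : Alt V ℝ (p + 1)),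
    contract p z α = 0 → ∀ X : Fin (p + 1) → V, α (fun a => X a - l (X a) • z) = α X
  | 0, α, h, X => by
    have e : ∀ Y : Fin 1 → V, α Y = contract 0 (Y 0) α ![] := by
      intro Y
      rw [contract_apply]
      congr 1
      funext k
      fin_cases k
      rfl
    rw [e, e X]
    simp [h]
  | p + 1, α, h, X => by
    have e : ∀ Y : Fin (p + 2) → V, α Y = contract (p + 1) (Y 0) α (Matrix.vecTail Y) := by
      intro Y
      rw [contract_apply]
      congr 1
      funext k
      refine Fin.cases rfl (fun k => rfl) k
    rw [e, e X]
    have e2 : contract (p + 1) (X 0 - l (X 0) • z) α = contract (p + 1) (X 0) α := by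
      simp [h]
    rw [e2]
    refine alt_proj_eq l z hz p _ ?_ (Matrix.vecTail X)
    rw [contract_comm, h]
    simp

/-- Contraction of `l ∧ α` with a vector dual to `l` is the pullback of `α` along the projection
onto `ker l`. -/
theorem contract_wedge_eq_proj (l : V →L[ℝ] ℝ) (z : V) (hz : l z = 1) :
    ∀ (p : ℕ) (α : Alt V ℝ p) (X : Fin p → V),
      contract p z (wedge l p α) X = α (fun a => X a - l (X a) • z)
  | 0, α, X => by
    rw [contract_wedge_zero, hz, one_smul]
    congr 1
    exact Subsingleton.elim _ _
  | p + 1, α, X => by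
    have h1 : contract p z (contract (p + 1) z (wedge l (p + 1) α)) = 0 := contract_self _ _
    rw [← alt_proj_eq l z hz p _ h1 X, contract_wedge]
    have h2 : ∀ β : Alt V ℝ p, wedge l p β (fun a => X a - l (X a) • z) = 0 := by
      intro β
      rw [wedge_apply]
      refine Finset.sum_eq_zero fun a _ => ?_
      simp [hz]
    simp [h2, hz]

theorem wedge_eq_zero_imp (l : V →L[ℝ] ℝ) (z : V) (hz : l z = 1) (α : Alt V ℝ p)
    (h : wedge l p α = 0) (X : Fin p → V) (hX : ∀ a, l (X a) = 0) : α X = 0 := by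
  have := contract_wedge_eq_proj l z hz p α X
  rw [h] at this
  simpa [hX] using this.symm

/-- The contraction of `l ∧ α` with `z` only sees `α` on `ker l`, so it vanishes. The antiderivation
rule applied to `l ∧ (l ∧ α) = 0` then recovers `l ∧ α` itself. -/
theorem wedge_eq_zero_of_ker (l : V →L[ℝ] ℝ) (z : V) (hz : l z = 1) (α : Alt V ℝ p)
    (h : ∀ X : Fin p → V, (∀ a, l (X a) = 0) → α X = 0) : wedge l p α = 0 := by
  have h0 : contract p z (wedge l p α) = 0 := by
    ext X
    rw [contract_wedge_eq_proj l z hz]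
    exact h _ fun a => by simp [hz]
  have h1 := contract_wedge l z (wedge l p α)
  have h2 : wedge l (p + 1) (wedge l p α) = 0 := by
    have := wedge_wedge l l p α
    rwa [← two_smul ℝ, smul_eq_zero_iff_right two_ne_zero] at this
  rw [h0, h2, hz] at h1
  simpa using h1.symm

end AltOperators

/-! ### Coordinates -/

/-- The tuple of standard basis vectors of `ℝ^N` with indices `f`. -/
def ev {N p : ℕ} (f : Fin p → Fin N) : Fin p → Fin N → ℝ := fun a => Pi.single (f a) 1

section Coordinates

variable {N p q : ℕ}

theorem alt_ext_ev {F : Type*} [NormedAddCommGroup F] [NormedSpace ℝ F]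
    {α β : Alt (Fin N → ℝ) F p} (h : ∀ f : Fin p → Fin N, α (ev f) = β (ev f)) : α = β := by
  apply ContinuousAlternatingMap.toAlternatingMap_injective
  refine Module.Basis.ext_alternating (Pi.basisFun ℝ (Fin N)) fun f _ => ?_
  have e : (fun a => Pi.basisFun ℝ (Fin N) (f a)) = ev f := by
    funext a
    simp [ev]
  rw [e]
  exact h f

theorem alt_eq_zero_of_lt {F : Type*} [NormedAddCommGroup F] [NormedSpace ℝ F]
    (α : Alt (Fin N → ℝ) F p) (h : N < p) : α = 0 := by
  refine alt_ext_ev fun f => ?_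
  obtain ⟨a, b, hab, hf⟩ := Fintype.exists_ne_map_eq_of_card_lt f (by simpa using h)
  exact α.map_eq_zero_of_eq _ (i := a) (j := b) (by simp [ev, hf]) hab

theorem dcov_ext_ev {φ ψ : DCov (Fin N → ℝ) p q}
    (h : ∀ (f : Fin p → Fin N) (g : Fin q → Fin N), φ (ev f) (ev g) = ψ (ev f) (ev g)) : φ = ψ :=
  alt_ext_ev fun f => alt_ext_ev fun g => h f g

instance alt_finiteDimensional {F : Type*} [NormedAddCommGroup F] [NormedSpace ℝ F]
    [FiniteDimensional ℝ F] : FiniteDimensional ℝ (Alt (Fin N → ℝ) F p) := by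
  let L : Alt (Fin N → ℝ) F p →ₗ[ℝ] ((Fin p → Fin N) → F) :=
    { toFun := fun α f => α (ev f)
      map_add' := fun _ _ => rfl
      map_smul' := fun _ _ => rfl }
  exact FiniteDimensional.of_injective L fun α β h => alt_ext_ev fun f => congrFun h f

/-- The `i`-th coordinate covector of `ℝ^N`. -/
abbrev coord (i : Fin N) : (Fin N → ℝ) →L[ℝ] ℝ := ContinuousLinearMap.proj i

/-- The `i`-th standard basis vector of `ℝ^N`. -/
abbrev bv (i : Fin N) : Fin N → ℝ := Pi.single i 1

theorem vecCons_ev (i : Fin N) (f : Fin p → Fin N) :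
    (Matrix.vecCons (bv i) (ev f) : Fin (p + 1) → Fin N → ℝ) = ev (Matrix.vecCons i f) := by
  funext k
  refine Fin.cases rfl (fun k => rfl) k

theorem removeNth_ev (a : Fin (p + 1)) (f : Fin (p + 1) → Fin N) :
    a.removeNth (ev f) = ev (a.removeNth f) := rfl

theorem coord_ev (i : Fin N) (f : Fin p → Fin N) (a : Fin p) :
    coord i (ev f a) = if f a = i then 1 else 0 := by
  simp [ev, Pi.single_apply, eq_comm]

/-- The number of occurrences of `i` in a multi-index. -/
def occ (i : Fin N) (f : Fin p → Fin N) : ℕ := ∑ a, if f a = i then 1 else 0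

theorem occ_vecCons (i j : Fin N) (f : Fin p → Fin N) :
    occ i (Matrix.vecCons j f) = (if j = i then 1 else 0) + occ i f := by
  rw [occ, Fin.sum_univ_succ]
  rfl

theorem sum_occ (f : Fin p → Fin N) : ∑ i, occ i f = p := by
  simp only [occ]
  rw [Finset.sum_comm]
  simp

theorem exists_of_occ_pos {i : Fin N} {f : Fin p → Fin N} (h : occ i f ≠ 0) : ∃ a, f a = i := by
  by_contra hc
  push Not at hc
  exact h (Finset.sum_eq_zero fun a _ => by simp [hc a])

/-- This is the number operator of the index `i`: it is diagonal on components, and these occupation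
numbers are the weights that reappear as exponents in the monomials of `Φ^*φ`. -/
theorem wedge_contract_ev (i : Fin N) (α : Alt (Fin N → ℝ) ℝ (p + 1))
    (f : Fin (p + 1) → Fin N) :
    wedge (coord i) p (contract p (bv i) α) (ev f) = occ i f * α (ev f) := by
  rw [wedge_apply, occ]
  push_cast
  rw [Finset.sum_mul]
  refine Finset.sum_congr rfl fun a _ => ?_
  rw [coord_ev]
  split_ifs with h
  · rw [contract_apply, alt_vecCons_removeNth α a _ _ (by simp [ev, h])]
    rw [one_mul, one_mul, ← mul_assoc, ← pow_add, Even.neg_one_pow (by simp), one_mul]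
  · simp

theorem contract_eq_sum (x : Fin N → ℝ) (α : Alt (Fin N → ℝ) ℝ (p + 1)) :
    contract p x α = ∑ i, x i • contract p (bv i) α := by
  conv_lhs => rw [← Finset.univ_sum_single x]
  have : ∀ i, (Pi.single i (x i) : Fin N → ℝ) = x i • bv i := by
    intro i; simp [bv, ← Pi.single_smul]
  simp [this]

end Coordinates

/-! ### Two commuting families of fermionic operators -/

theorem sum_sum_eq_zero_of_antisymm {ι M : Type*} [Fintype ι] [AddCommGroup M] [Module ℝ M] (F : ι → ι → M)
    (h : ∀ j k, F j k = -F k j) : ∑ j, ∑ k, F j k = 0 := by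
  have h1 : ∑ j, ∑ k, F j k = -∑ j, ∑ k, F j k := by
    conv_lhs => rw [Finset.sum_comm]
    rw [← Finset.sum_neg_distrib]
    refine Finset.sum_congr rfl fun j _ => ?_
    rw [← Finset.sum_neg_distrib]
    exact Finset.sum_congr rfl fun k _ => h k j
  rw [eq_neg_iff_add_eq_zero, ← two_smul ℝ, smul_eq_zero_iff_right two_ne_zero] at h1
  exact h1

section Fermionic

variable {R ι : Type*} [Ring R] [DecidableEq ι] {w c w' c' : ι → R}

/-- The canonical anticommutation relations for creation operators `w` and annihilation
operators `c`. -/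
structure IsCAR (w c : ι → R) : Prop where
  cc : ∀ j k, c j * c k = -(c k * c j)
  ww : ∀ j k, w j * w k = -(w k * w j)
  cw : ∀ j k, c j * w k = (if j = k then 1 else 0) - w k * c j
  c_sq : ∀ j, c j * c j = 0

/-- Two commuting representations of the canonical anticommutation relations. -/
structure IsDoubleCAR (w c w' c' : ι → R) : Prop where
  left : IsCAR w c
  right : IsCAR w' c'
  comm_ww : ∀ j k, w j * w' k = w' k * w j
  comm_wc : ∀ j k, w j * c' k = c' k * w j
  comm_cw : ∀ j k, c j * w' k = w' k * c j
  comm_cc : ∀ j k, c j * c' k = c' k * c j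

theorem IsDoubleCAR.symm (h : IsDoubleCAR w c w' c') :
    IsDoubleCAR w' c' w c where
  left := h.right
  right := h.left
  comm_ww j k := (h.comm_ww k j).symm
  comm_wc j k := (h.comm_cw k j).symm
  comm_cw j k := (h.comm_wc k j).symm
  comm_cc j k := (h.comm_cc k j).symm

theorem IsCAR.number_w (h : IsCAR w c) (j k : ι) :
    w k * c k * w j = w j * (w k * c k) + if k = j then w j else 0 := by
  rw [mul_assoc, h.cw, mul_sub, ← mul_assoc (w k), h.ww k j]
  split_ifs with hk
  · subst hk; noncomm_ring
  · noncomm_ring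

theorem IsCAR.number_c (h : IsCAR w c) (j k : ι) :
    w k * c k * c j = c j * (w k * c k) - if k = j then c j else 0 := by
  rw [← mul_assoc (c j), h.cw, sub_mul, mul_assoc, h.cc k j]
  split_ifs with h1 h2 h2
  · subst h1; noncomm_ring
  · exact absurd h1.symm h2
  · exact absurd h2.symm h1
  · noncomm_ring

theorem IsCAR.c_number (h : IsCAR w c) (k : ι) : c k * (w k * c k) = c k := by
  rw [← mul_assoc, h.cw, sub_mul, mul_assoc, h.c_sq]
  simp

theorem IsCAR.number_comm (h : IsCAR w c) (j k : ι) :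
    w k * c k * (w j * c j) = w j * c j * (w k * c k) := by
  rw [← mul_assoc, h.number_w, add_mul, mul_assoc (w j), h.number_c]
  split_ifs with hk
  · noncomm_ring
  · noncomm_ring

variable [Fintype ι]

/-- The operator `∑ₖ wₖ c'ₖ`. -/
def transfer (w c' : ι → R) : R := ∑ k, w k * c' k

/-- With `s = ∑ wₖ c'ₖ`, the factor `c'ₖ` meets `w'ⱼ` and leaves `wₖ` on the diagonal. So `s`
converts right multiplication by `dσ` into left multiplication. -/
theorem IsDoubleCAR.transfer_sum_right (h : IsDoubleCAR w c w' c') :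
    transfer w c' * (∑ j, w' j) + (∑ j, w' j) * transfer w c' = ∑ j, w j := by
  rw [transfer, Finset.sum_mul_sum, Finset.sum_mul_sum,
    Finset.sum_comm (s := Finset.univ) (f := fun j k => w' j * _), ← Finset.sum_add_distrib]
  refine Finset.sum_congr rfl fun k _ => ?_
  rw [← Finset.sum_add_distrib]
  have key : ∀ j, w k * c' k * w' j + w' j * (w k * c' k) = if k = j then w k else 0 := by
    intro j
    rw [← mul_assoc, ← h.comm_ww, mul_assoc, h.right.cw, mul_assoc]
    split_ifs <;> noncomm_ring
  simp_rw [key]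
  simp

theorem IsDoubleCAR.transfer_sum_left (h : IsDoubleCAR w c w' c') :
    transfer w c' * (∑ j, w j) + (∑ j, w j) * transfer w c' = 0 := by
  rw [transfer, Finset.sum_mul_sum, Finset.sum_mul_sum,
    Finset.sum_comm (s := Finset.univ) (f := fun j k => w j * _), ← Finset.sum_add_distrib]
  refine Finset.sum_eq_zero fun k _ => ?_
  rw [← Finset.sum_add_distrib]
  refine Finset.sum_eq_zero fun j _ => ?_
  rw [mul_assoc, ← h.comm_wc, ← mul_assoc, h.left.ww k j]
  noncomm_ring

theorem IsDoubleCAR.sum_comm (h : IsDoubleCAR w c w' c') :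
    (∑ j, w j) * ∑ j, w' j = (∑ j, w' j) * ∑ j, w j := by
  rw [Finset.sum_mul_sum, Finset.sum_mul_sum, Finset.sum_comm]
  exact Finset.sum_congr rfl fun j _ => Finset.sum_congr rfl fun k _ => h.comm_ww k j

/-- The `sl₂` relation: the commutator of `s` and `s*` is the left degree minus the right degree. -/
theorem IsDoubleCAR.transfer_comm (h : IsDoubleCAR w c w' c') :
    transfer w c' * transfer w' c - transfer w' c * transfer w c'
      = ∑ k, w k * c k - ∑ k, w' k * c' k := by
  rw [transfer, transfer, Finset.sum_mul_sum, Finset.sum_mul_sum,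
    Finset.sum_comm (s := Finset.univ) (f := fun j k => w' j * _ * _), ← Finset.sum_sub_distrib,
    ← Finset.sum_sub_distrib]
  refine Finset.sum_congr rfl fun k _ => ?_
  rw [← Finset.sum_sub_distrib]
  have key : ∀ j, w k * c' k * (w' j * c j) - w' j * c j * (w k * c' k)
      = if k = j then w k * c k - w' k * c' k else 0 := by
    intro j
    have e1 : w k * c' k * (w' j * c j) = w k * (c' k * w' j) * c j := by noncomm_ring
    have e2 : w' j * c j * (w k * c' k) = w' j * (c j * w k) * c' k := by noncomm_ring
    have e3 : w k * (w' j * c' k) * c j = w' j * (w k * c j) * c' k := by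
      rw [← mul_assoc, h.comm_ww, mul_assoc, ← h.comm_cc]
      noncomm_ring
    rw [e1, e2, h.right.cw, h.left.cw, mul_sub, sub_mul, e3]
    by_cases hk : k = j
    · subst hk
      simp only [if_true]
      noncomm_ring
    · simp only [if_neg hk, if_neg (Ne.symm hk)]
      noncomm_ring
  simp_rw [key]
  simp

variable [Algebra ℝ R]

/-- The weighted contraction `∑ₖ cₖ (aₖ + w'ₖ c'ₖ)`. -/
def weighted (a : ι → ℝ) (c w' c' : ι → R) : R :=
  ∑ k, c k * (algebraMap ℝ R (a k) + w' k * c' k)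

variable {a : ι → ℝ}

/-- The weights `aₖ + wₖcₖ` commute with each other and with every `c'ⱼ`, so the double sum inherits
the antisymmetry of `c'ⱼ c'ₖ`. -/
theorem IsDoubleCAR.weighted_right_sq (h : IsDoubleCAR w c w' c') :
    weighted a c' w c * weighted a c' w c = 0 := by
  rw [weighted, Finset.sum_mul_sum]
  refine sum_sum_eq_zero_of_antisymm _ fun j k => ?_
  have e1 : ∀ j k, (algebraMap ℝ R (a j) + w j * c j) * c' k
      = c' k * (algebraMap ℝ R (a j) + w j * c j) := by
    intro j k
    rw [add_mul, mul_add, Algebra.commutes, mul_assoc, h.comm_cc, ← mul_assoc, h.comm_wc,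
      mul_assoc]
  have e2 : (algebraMap ℝ R (a j) + w j * c j) * (algebraMap ℝ R (a k) + w k * c k)
      = (algebraMap ℝ R (a k) + w k * c k) * (algebraMap ℝ R (a j) + w j * c j) := by
    have h1 := h.left.number_comm k j
    have h2 := Algebra.commutes (a j) (w k * c k)
    have h3 := Algebra.commutes (a k) (w j * c j)
    have h4 := Algebra.commutes (a k) (algebraMap ℝ R (a j))
    rw [add_mul, mul_add, mul_add, add_mul, mul_add, mul_add, h1, h2, h3, h4]
    abel
  calc c' j * (algebraMap ℝ R (a j) + w j * c j) * (c' k * (algebraMap ℝ R (a k) + w k * c k))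
      = c' j * ((algebraMap ℝ R (a j) + w j * c j) * c' k)
        * (algebraMap ℝ R (a k) + w k * c k) := by noncomm_ring
    _ = c' j * c' k * ((algebraMap ℝ R (a j) + w j * c j)
        * (algebraMap ℝ R (a k) + w k * c k)) := by rw [e1]; noncomm_ring
    _ = -(c' k * (c' j * (algebraMap ℝ R (a k) + w k * c k))
        * (algebraMap ℝ R (a j) + w j * c j)) := by rw [e2, h.right.cc j k]; noncomm_ring
    _ = _ := by rw [← e1]; noncomm_ring

/-- Moving `wⱼ` past the number operator of `k` produces an extra term only for `k = j`, and that
term carries `c'ⱼ c'ⱼ = 0`. What is left cancels by anticommutation. -/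
theorem IsDoubleCAR.transfer_weighted_right (h : IsDoubleCAR w c w' c') :
    transfer w c' * weighted a c' w c + weighted a c' w c * transfer w c' = 0 := by
  rw [transfer, weighted, Finset.sum_mul_sum, Finset.sum_mul_sum, Finset.sum_comm,
    ← Finset.sum_add_distrib]
  refine Finset.sum_eq_zero fun k _ => ?_
  rw [← Finset.sum_add_distrib]
  refine Finset.sum_eq_zero fun j _ => ?_
  have h1 := h.left.number_w j k
  have h2 := Algebra.commutes (a k) (w j)
  have h3 := h.comm_wc j k
  have h4 := h.comm_wc j j
  have h5 := h.right.cc j k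
  have h6 := h.right.c_sq j
  have h8 : (if k = j then w j else 0) * c' j = c' j * (if k = j then w j else 0) := by
    split_ifs <;> simp [h4]
  have h9 : c' k * c' j * (if k = j then w j else 0) = 0 := by
    split_ifs with hk
    · subst hk; rw [h6, zero_mul]
    · simp
  have h7 : (algebraMap ℝ R (a k) + w k * c k) * (w j * c' j)
      = c' j * (w j * (algebraMap ℝ R (a k) + w k * c k) + if k = j then w j else 0) := by
    have e : (algebraMap ℝ R (a k) + w k * c k) * (w j * c' j)
      = algebraMap ℝ R (a k) * w j * c' j + w k * c k * w j * c' j := by noncomm_ring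
    rw [e, h1, h2, add_mul, h8]
    have e1 : w j * (w k * c k) * c' j = c' j * (w j * (w k * c k)) := by
      rw [mul_assoc, mul_assoc, h.comm_cc, ← mul_assoc (w k), h.comm_wc, ← mul_assoc, ← mul_assoc,
        h4]
      noncomm_ring
    rw [e1, mul_assoc, Algebra.commutes, ← mul_assoc, h4]
    noncomm_ring
  have h10 : c' k * (algebraMap ℝ R (a k) + w k * c k) * (w j * c' j)
      = c' k * c' j * (w j * (algebraMap ℝ R (a k) + w k * c k)) := by
    rw [mul_assoc, h7, mul_add, mul_add, ← mul_assoc (c' k) (c' j) (if k = j then w j else 0), h9]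
    noncomm_ring
  rw [h10]
  have h11 : w j * c' j * (c' k * (algebraMap ℝ R (a k) + w k * c k))
      = c' j * (w j * c' k) * (algebraMap ℝ R (a k) + w k * c k) := by
    rw [h4]; noncomm_ring
  rw [h11, h3]
  have h12 : c' j * (c' k * w j) * (algebraMap ℝ R (a k) + w k * c k)
    = (c' j * c' k) * (w j * (algebraMap ℝ R (a k) + w k * c k)) := by noncomm_ring
  rw [h12, h5]
  noncomm_ring

/-- Only the diagonal anticommutators of `wⱼ` with `cⱼ` survive. The correction from moving `c'ⱼ`
past its number operator is cancelled because `c'ⱼ w'ⱼ c'ⱼ = c'ⱼ`. Thus `Aᴸ, Aᴿ` behave under `s`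
exactly as `∑ w'ⱼ, ∑ wⱼ` do. -/
theorem IsDoubleCAR.transfer_weighted_left (h : IsDoubleCAR w c w' c') :
    transfer w c' * weighted a c w' c' + weighted a c w' c' * transfer w c'
      = weighted a c' w c := by
  have key : ∀ j k, w j * c' j * (c k * (algebraMap ℝ R (a k) + w' k * c' k))
      + c k * (algebraMap ℝ R (a k) + w' k * c' k) * (w j * c' j)
      = if j = k then c' k * (algebraMap ℝ R (a k) + w k * c k) else 0 := by
    intro j k
    have e1 : (algebraMap ℝ R (a k) + w' k * c' k) * (w j * c' j)
        = w j * ((algebraMap ℝ R (a k) + w' k * c' k) * c' j) := by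
      have : (algebraMap ℝ R (a k) + w' k * c' k) * w j
          = w j * (algebraMap ℝ R (a k) + w' k * c' k) := by
        rw [add_mul, mul_add, Algebra.commutes, mul_assoc, ← h.comm_wc, ← mul_assoc,
          ← h.comm_ww, mul_assoc]
      rw [← mul_assoc, this, mul_assoc]
    have e2 : (algebraMap ℝ R (a k) + w' k * c' k) * c' j
        = c' j * (algebraMap ℝ R (a k) + w' k * c' k) - if k = j then c' j else 0 := by
      rw [add_mul, h.right.number_c, Algebra.commutes, mul_add]
      abel
    have e3 : w j * c' j * (c k * (algebraMap ℝ R (a k) + w' k * c' k))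
        = w j * c k * (c' j * (algebraMap ℝ R (a k) + w' k * c' k)) := by
      rw [mul_assoc, ← mul_assoc (c' j), ← h.comm_cc]
      noncomm_ring
    have e4 : c k * (algebraMap ℝ R (a k) + w' k * c' k) * (w j * c' j)
        = c k * w j * (c' j * (algebraMap ℝ R (a k) + w' k * c' k) - if k = j then c' j else 0) := by
      rw [mul_assoc, e1, e2]
      noncomm_ring
    rw [e3, e4, h.left.cw]
    by_cases hjk : j = k
    · subst hjk
      simp only [if_true]
      have e5 : c' j * (algebraMap ℝ R (a j) + w' j * c' j)
          = c' j * algebraMap ℝ R (a j) + c' j := by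
        rw [mul_add, h.right.c_number]
      have e6 : w j * c j * c' j = c' j * (w j * c j) := by
        rw [mul_assoc, h.comm_cc, ← mul_assoc, h.comm_wc, mul_assoc]
      rw [e5, mul_add (c' j), ← e6]
      noncomm_ring
    · simp only [if_neg hjk, if_neg (Ne.symm hjk)]
      noncomm_ring
  rw [transfer, weighted, weighted, Finset.sum_mul_sum, Finset.sum_mul_sum,
    Finset.sum_comm (s := Finset.univ) (f := fun k j => c k * _ * (w j * c' j)),
    ← Finset.sum_add_distrib]
  refine Finset.sum_congr rfl fun j _ => ?_
  rw [← Finset.sum_add_distrib]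
  simp_rw [key]
  simp

theorem IsDoubleCAR.weighted_sum_left (h : IsDoubleCAR w c w' c') :
    weighted a c w' c' * (∑ j, w j) + (∑ j, w j) * weighted a c w' c'
      = algebraMap ℝ R (∑ k, a k) + ∑ k, w' k * c' k := by
  have key : ∀ j k, c k * (algebraMap ℝ R (a k) + w' k * c' k) * w j
      + w j * (c k * (algebraMap ℝ R (a k) + w' k * c' k))
      = if k = j then algebraMap ℝ R (a k) + w' k * c' k else 0 := by
    intro j k
    have : (algebraMap ℝ R (a k) + w' k * c' k) * w j
        = w j * (algebraMap ℝ R (a k) + w' k * c' k) := by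
      rw [add_mul, mul_add, Algebra.commutes, mul_assoc, ← h.comm_wc, ← mul_assoc,
        ← h.comm_ww, mul_assoc]
    rw [mul_assoc, this, ← mul_assoc, h.left.cw]
    split_ifs <;> noncomm_ring
  rw [weighted, Finset.sum_mul_sum, Finset.sum_mul_sum,
    Finset.sum_comm (s := Finset.univ) (f := fun j k => w j * _), ← Finset.sum_add_distrib,
    map_sum, ← Finset.sum_add_distrib]
  refine Finset.sum_congr rfl fun k _ => ?_
  rw [← Finset.sum_add_distrib]
  simp_rw [key]
  simp

/-- Only the number operators inside the weights fail to commute with `∑ wⱼ`. Each contributes a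
`wₖ`, and these assemble into `s`. -/
theorem IsDoubleCAR.weighted_right_sum_left (h : IsDoubleCAR w c w' c') :
    weighted a c' w c * (∑ j, w j) = (∑ j, w j) * weighted a c' w c + transfer w c' := by
  have key : ∀ j k, c' k * (algebraMap ℝ R (a k) + w k * c k) * w j
      = w j * (c' k * (algebraMap ℝ R (a k) + w k * c k)) + if k = j then w k * c' k else 0 := by
    intro j k
    have : (algebraMap ℝ R (a k) + w k * c k) * w j
        = w j * (algebraMap ℝ R (a k) + w k * c k) + if k = j then w j else 0 := by
      rw [add_mul, mul_add, Algebra.commutes, h.left.number_w, add_assoc]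
    rw [mul_assoc, this, mul_add, ← mul_assoc, ← h.comm_wc, mul_assoc]
    split_ifs with hk
    · subst hk; rw [h.comm_wc]
    · simp
  rw [weighted, Finset.sum_mul_sum, Finset.sum_mul_sum,
    Finset.sum_comm (s := Finset.univ) (f := fun j k => w j * _), transfer,
    ← Finset.sum_add_distrib]
  refine Finset.sum_congr rfl fun k _ => ?_
  simp_rw [key]
  rw [Finset.sum_add_distrib]
  simp

theorem IsCAR.sum_w_sq (h : IsCAR w c) : (∑ j, w j) * ∑ j, w j = 0 := by
  rw [Finset.sum_mul_sum]
  exact sum_sum_eq_zero_of_antisymm _ h.ww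

/-- The operator `φ ↦ Aᴸ Aᴿ (dσ ∧ᴸ dσ ∧ᴿ φ)` of a double CAR representation, `dσ = ∑ⱼ wⱼ`. -/
def extensionOp (a : ι → ℝ) (w c w' c' : ι → R) : R :=
  weighted a c w' c' * weighted a c' w c * ((∑ j, w j) * ∑ j, w' j)

/-- Moving `s` through the pair `Aᴸ Aᴿ` would leave an `Aᴿ Aᴿ`, and moving it through the pair of
exterior multiplications would leave `(∑ wⱼ)²`; both squares vanish. -/
theorem IsDoubleCAR.transfer_extensionOp (h : IsDoubleCAR w c w' c') :
    transfer w c' * extensionOp a w c w' c' = extensionOp a w c w' c' * transfer w c' := by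
  have h1 := eq_sub_of_add_eq (h.transfer_weighted_left (a := a))
  have h2 := eq_neg_of_add_eq_zero_left (h.transfer_weighted_right (a := a))
  have h3 := h.weighted_right_sq (a := a)
  have h4 := eq_neg_of_add_eq_zero_left h.transfer_sum_left
  have h5 := eq_sub_of_add_eq h.transfer_sum_right
  have h6 := h.left.sum_w_sq
  rw [extensionOp]
  set s := transfer w c'
  set A := weighted a c w' c'
  set B := weighted a c' w c
  set S := ∑ j, w j
  set S' := ∑ j, w' j
  have e1 : s * (A * B) = A * B * s := by
    rw [← mul_assoc, h1, sub_mul, h3, mul_assoc, h2]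
    noncomm_ring
  have e2 : s * (S * S') = S * S' * s := by
    rw [← mul_assoc, h4, neg_mul, mul_assoc, h5, mul_sub, h6]
    noncomm_ring
  rw [← mul_assoc, e1, mul_assoc, e2, mul_assoc]
  noncomm_ring

theorem IsDoubleCAR.transfer_extensionOp' (h : IsDoubleCAR w c w' c') :
    transfer w' c * extensionOp a w c w' c' = extensionOp a w c w' c' * transfer w' c := by
  have h1 := eq_sub_of_add_eq (h.symm.transfer_weighted_left (a := a))
  have h2 := eq_neg_of_add_eq_zero_left (h.symm.transfer_weighted_right (a := a))
  have h3 := h.symm.weighted_right_sq (a := a)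
  have h4 := eq_neg_of_add_eq_zero_left h.symm.transfer_sum_left
  have h5 := eq_sub_of_add_eq h.symm.transfer_sum_right
  have h6 := h.right.sum_w_sq
  rw [extensionOp, h.sum_comm]
  set s := transfer w' c
  set A := weighted a c w' c'
  set B := weighted a c' w c
  set S := ∑ j, w j
  set S' := ∑ j, w' j
  have e1 : s * (A * B) = A * B * s := by
    rw [← mul_assoc, h2, neg_mul, mul_assoc, h1, mul_sub, h3]
    noncomm_ring
  have e2 : s * (S' * S) = S' * S * s := by
    rw [← mul_assoc, h4, neg_mul, mul_assoc, h5, mul_sub, h6]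
    noncomm_ring
  rw [← mul_assoc, e1, mul_assoc, e2, mul_assoc]
  noncomm_ring

/-- This is the source of the constant `C`. The exterior multiplications are moved through `Aᴸ Aᴿ`.
Their anticommutators with the contractions give the weighted total degrees, and all terms with a
repeated exterior multiplication vanish. -/
theorem IsDoubleCAR.sum_mul_extensionOp (h : IsDoubleCAR w c w' c') :
    (∑ j, w j) * (∑ j, w' j) * extensionOp a w c w' c'
      = (∑ j, w j) * (∑ j, w' j) *
        ((algebraMap ℝ R (∑ k, a k) + ∑ k, w' k * c' k)
          * (algebraMap ℝ R (∑ k, a k) + ∑ k, w k * c k + 1) - transfer w' c * transfer w c') := by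
  have h1 := eq_sub_of_add_eq (h.weighted_sum_left (a := a))
  have h2 := eq_sub_of_add_eq (h.symm.weighted_sum_left (a := a))
  have h3 := h.weighted_right_sum_left (a := a)
  have h4 := h.symm.weighted_right_sum_left (a := a)
  have h5 := eq_sub_of_add_eq h.transfer_sum_right
  have h6 := h.left.sum_w_sq
  have h7 := h.right.sum_w_sq
  have h8 := h.sum_comm
  rw [extensionOp]
  set s := transfer w c'
  set t := transfer w' c
  set A := weighted a c w' c'
  set B := weighted a c' w c
  set S := ∑ j, w j
  set S' := ∑ j, w' j
  set HL := algebraMap ℝ R (∑ k, a k) + ∑ k, w' k * c' k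
  set HR := algebraMap ℝ R (∑ k, a k) + ∑ k, w k * c k
  -- The `+ 1` comes from the `s` created by moving `B` past `S`: on meeting `S'` it yields another
  -- `S`.
  have e1 : B * (S * S') = S * (HR + 1) - S * S' * B - S' * s := by
    rw [← mul_assoc, h3, add_mul, mul_assoc, h2, h5]
    noncomm_ring
  have e2 : S * A * S = S * HL := by
    rw [mul_assoc, h1, mul_sub, ← mul_assoc S S, h6]
    noncomm_ring
  have e3 : S * S' * A * S = S * S' * HL := by
    rw [h8, mul_assoc S', mul_assoc S', e2, mul_assoc]
  -- Moving `A` past `S'` leaves `t`, and `S t S = S S'`; the remaining outer `S'` then makes the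
  -- product vanish.
  have e4 : S * S' * A * (S * S') = 0 := by
    have : S' * (A * S') = S' * t := by
      rw [h4, mul_add, ← mul_assoc, h7]; noncomm_ring
    have e : S * S' * A * (S * S') = S * S' * (A * S') * S := by rw [h8]; noncomm_ring
    have e' : S * S' * t * S = S' * (S * t * S) := by rw [h8]; noncomm_ring
    have e'' : S * t * S = S * S' := by
      rw [mul_assoc, eq_sub_of_add_eq h.symm.transfer_sum_right, mul_sub, ← mul_assoc S S, h6]
      noncomm_ring
    rw [e, mul_assoc S, this, ← mul_assoc, e', e'', h8, ← mul_assoc, h7, zero_mul]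
  have e5 : S * S' * A * (S' * s) = S * S' * (t * s) := by
    have : S' * (A * S') = S' * t := by
      rw [h4, mul_add, ← mul_assoc, h7]; noncomm_ring
    have e : S * S' * A * (S' * s) = S * (S' * (A * S')) * s := by noncomm_ring
    rw [e, this]; noncomm_ring
  have e6 : S * S' * (A * B * (S * S')) = S * S' * A * (B * (S * S')) := by noncomm_ring
  rw [e6, e1, mul_sub, mul_sub, e5]
  have e7 : S * S' * A * (S * (HR + 1)) = S * S' * A * S * (HR + 1) := by noncomm_ring
  have e8 : S * S' * A * (S * S' * B) = S * S' * A * (S * S') * B := by noncomm_ring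
  rw [e7, e3, e8, e4]
  noncomm_ring

end Fermionic

/-! ### Operators on double covectors -/

section DCovOperators

variable {V : Type*} [NormedAddCommGroup V] [NormedSpace ℝ V] {p q p' q' : ℕ}

/-- The operator `id ⊗ B`. -/
def mapR (p : ℕ) (B : Alt V ℝ q →L[ℝ] Alt V ℝ q') : DCov V p q →ₗ[ℝ] DCov V p q' where
  toFun φ := B.compContinuousAlternatingMap φ
  map_add' φ ψ := by ext X Y; simp
  map_smul' c φ := by ext X Y; simp

theorem mapR_apply (B : Alt V ℝ q →L[ℝ] Alt V ℝ q') (φ : DCov V p q) (X : Fin p → V) :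
    mapR p B φ X = B (φ X) := rfl

/-- The operator `A ⊗ id`. -/
def mapL (q : ℕ) (A : Alt V ℝ p →L[ℝ] Alt V ℝ p') : DCov V p q →ₗ[ℝ] DCov V p' q :=
  transpose ∘ₗ mapR q A ∘ₗ transpose

theorem transpose_transpose (φ : DCov V p q) : transpose (transpose φ) = φ := rfl

theorem mapL_apply (A : Alt V ℝ p →L[ℝ] Alt V ℝ p') (φ : DCov V p q) :
    mapL q A φ = transpose (mapR q A (transpose φ)) := rfl

theorem tensorMap_eq (A : Alt V ℝ p →L[ℝ] Alt V ℝ p') (B : Alt V ℝ q →L[ℝ] Alt V ℝ q')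
    (φ : DCov V p q) : tensorMap A B φ = mapL q' A (mapR p B φ) := rfl

theorem mapR_tmul (B : Alt V ℝ q →L[ℝ] Alt V ℝ q') (α : Alt V ℝ p) (β : Alt V ℝ q) :
    mapR p B (tmul α β) = tmul α (B β) := by
  ext X Y
  simp [mapR_apply, tmul]

theorem mapL_tmul (A : Alt V ℝ p →L[ℝ] Alt V ℝ p') (α : Alt V ℝ p) (β : Alt V ℝ q) :
    mapL q A (tmul α β) = tmul (A α) β := by
  have h : mapL q A (tmul α β) = tensorMap A (ContinuousLinearMap.id ℝ _) (tmul α β) := rfl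
  rw [h, tensorMap_tmul]
  rfl

end DCovOperators

/-! ### Creation and annihilation operators on double covectors of all bidegrees. -/

section CoordinateOperators

variable {N p q p' q' : ℕ}

theorem dcov_eq_sum_tmul (φ : DCov (Fin N → ℝ) p q) :
    ∃ (k : ℕ) (α : Fin k → Alt (Fin N → ℝ) ℝ p) (β : Fin k → Alt (Fin N → ℝ) ℝ q),
      φ = ∑ j, tmul (α j) (β j) := by
  let b := Module.finBasis ℝ (Alt (Fin N → ℝ) ℝ q)
  refine ⟨_, fun j => (LinearMap.toContinuousLinearMap (b.coord j)).compContinuousAlternatingMap φ,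
    fun j => b j, ?_⟩
  ext X Y
  have h := congrArg (fun γ : Alt (Fin N → ℝ) ℝ q => γ Y) (b.sum_repr (φ X))
  simp_all [tmul, ContinuousAlternatingMap.sum_apply]

/-- In finite dimension simple tensors span, so operator identities such as the commutation of left
and right operators need checking on them only. -/
theorem dcov_hom_ext {M : Type*} [AddCommGroup M] [Module ℝ M]
    {S T : DCov (Fin N → ℝ) p q →ₗ[ℝ] M}
    (h : ∀ α β, S (tmul α β) = T (tmul α β)) (φ : DCov (Fin N → ℝ) p q) : S φ = T φ := by
  obtain ⟨k, α, β, rfl⟩ := dcov_eq_sum_tmul φ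
  simp [h]

theorem mapL_mapR_comm (A : Alt (Fin N → ℝ) ℝ p →L[ℝ] Alt (Fin N → ℝ) ℝ p')
    (B : Alt (Fin N → ℝ) ℝ q →L[ℝ] Alt (Fin N → ℝ) ℝ q') (φ : DCov (Fin N → ℝ) p q) :
    mapL q' A (mapR p B φ) = mapR p' B (mapL q A φ) :=
  dcov_hom_ext (S := mapL q' A ∘ₗ mapR p B) (T := mapR p' B ∘ₗ mapL q A)
    (fun α β => by simp [mapR_tmul, mapL_tmul]) φ

/-- Double covectors of all bidegrees. -/
def DCovs (N : ℕ) : Type := ∀ p q : ℕ, DCov (Fin N → ℝ) p q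

instance : AddCommGroup (DCovs N) :=
  inferInstanceAs (AddCommGroup (∀ p q : ℕ, DCov (Fin N → ℝ) p q))

instance : Module ℝ (DCovs N) :=
  inferInstanceAs (Module ℝ (∀ p q : ℕ, DCov (Fin N → ℝ) p q))

namespace DCovs

variable (φ ψ : DCovs N) (c : ℝ) (p q : ℕ)

@[simp] theorem add_apply : (φ + ψ) p q = φ p q + ψ p q := rfl
@[simp] theorem sub_apply : (φ - ψ) p q = φ p q - ψ p q := rfl
@[simp] theorem smul_apply : (c • φ) p q = c • φ p q := rfl
@[simp] theorem neg_apply : (-φ) p q = -φ p q := rfl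
@[simp] theorem zero_apply : (0 : DCovs N) p q = 0 := rfl

/-- The component of bidegree `(p,q)`. -/
def component : DCovs N →ₗ[ℝ] DCov (Fin N → ℝ) p q where
  toFun φ := φ p q
  map_add' _ _ := rfl
  map_smul' _ _ := rfl

@[simp] theorem sum_apply {ι : Type*} (s : Finset ι) (f : ι → DCovs N) :
    (∑ k ∈ s, f k) p q = ∑ k ∈ s, f k p q :=
  map_sum (component p q) f s

end DCovs

/-- Left exterior multiplication by the `i`-th coordinate covector. -/
def wL (i : Fin N) : Module.End ℝ (DCovs N) where
  toFun φ := fun p q => match p with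
    | 0 => 0
    | p + 1 => mapL q (wedge (coord i) p) (φ p q)
  map_add' φ ψ := by
    funext p q
    rcases p with _ | p
    · exact (add_zero _).symm
    · exact map_add (mapL q (wedge (coord i) p)) (φ p q) (ψ p q)
  map_smul' c φ := by
    funext p q
    rcases p with _ | p
    · exact (smul_zero c).symm
    · exact map_smul (mapL q (wedge (coord i) p)) c (φ p q)

/-- Right exterior multiplication by the `i`-th coordinate covector. -/
def wR (i : Fin N) : Module.End ℝ (DCovs N) where
  toFun φ := fun p q => match q with
    | 0 => 0
    | q + 1 => mapR p (wedge (coord i) q) (φ p q)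
  map_add' φ ψ := by
    funext p q
    rcases q with _ | q
    · exact (add_zero _).symm
    · exact map_add (mapR p (wedge (coord i) q)) (φ p q) (ψ p q)
  map_smul' c φ := by
    funext p q
    rcases q with _ | q
    · exact (smul_zero c).symm
    · exact map_smul (mapR p (wedge (coord i) q)) c (φ p q)

/-- Left contraction with the `i`-th basis vector. -/
def iL (i : Fin N) : Module.End ℝ (DCovs N) where
  toFun φ := fun p q => mapL q (contract p (bv i)) (φ (p + 1) q)
  map_add' φ ψ := by
    funext p q
    exact map_add (mapL q (contract p (bv i))) (φ (p + 1) q) (ψ (p + 1) q)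
  map_smul' c φ := by
    funext p q
    exact map_smul (mapL q (contract p (bv i))) c (φ (p + 1) q)

/-- Right contraction with the `i`-th basis vector. -/
def iR (i : Fin N) : Module.End ℝ (DCovs N) where
  toFun φ := fun p q => mapR p (contract q (bv i)) (φ p (q + 1))
  map_add' φ ψ := by
    funext p q
    exact map_add (mapR p (contract q (bv i))) (φ p (q + 1)) (ψ p (q + 1))
  map_smul' c φ := by
    funext p q
    exact map_smul (mapR p (contract q (bv i))) c (φ p (q + 1))

variable (i j : Fin N) (φ : DCovs N)

@[simp] theorem wL_zero : wL i φ 0 q = 0 := rfl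
@[simp] theorem wL_succ : wL i φ (p + 1) q = mapL q (wedge (coord i) p) (φ p q) := rfl
@[simp] theorem wR_zero : wR i φ p 0 = 0 := rfl
@[simp] theorem wR_succ : wR i φ p (q + 1) = mapR p (wedge (coord i) q) (φ p q) := rfl
@[simp] theorem iL_val : iL i φ p q = mapL q (contract p (bv i)) (φ (p + 1) q) := rfl
@[simp] theorem iR_val : iR i φ p q = mapR p (contract q (bv i)) (φ p (q + 1)) := rfl

theorem coord_bv : coord i (bv j) = if j = i then (1 : ℝ) else 0 := by
  simp [bv, Pi.single_apply, eq_comm]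

theorem isCAR_right : IsCAR (wR : Fin N → _) iR where
  cc j k := by
    ext1 φ; funext p q; apply ContinuousAlternatingMap.ext; intro X
    simpa [mapR_apply] using contract_comm _ _ _
  ww j k := by
    ext1 φ; funext p q; apply ContinuousAlternatingMap.ext; intro X
    rcases q with _ | _ | q
    · simp
    · simp
    · simpa [mapR_apply] using eq_neg_of_add_eq_zero_left (wedge_wedge _ _ _ _)
  cw j k := by
    ext1 φ; funext p q; apply ContinuousAlternatingMap.ext; intro X
    rcases q with _ | q
    · simp only [Module.End.mul_apply, iR_val, wR_succ, mapR_apply, contract_wedge_zero, coord_bv]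
      split_ifs <;> simp
    · simp only [Module.End.mul_apply, iR_val, wR_succ, mapR_apply, contract_wedge, coord_bv]
      split_ifs <;> simp [mapR_apply]
  c_sq j := by
    ext1 φ; funext p q; apply ContinuousAlternatingMap.ext; intro X
    simpa [mapR_apply] using contract_self _ _

/-- Transposition of the factors. -/
def swapLR (N : ℕ) : Module.End ℝ (DCovs N) where
  toFun φ := fun p q => transpose (φ q p)
  map_add' _ _ := rfl
  map_smul' _ _ := rfl

theorem swapLR_sq : swapLR N * swapLR N = 1 := by
  ext1 φ; funext p q; rfl

theorem wL_eq : wL i = swapLR N * wR i * swapLR N := by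
  ext1 φ; funext p q
  rcases p with _ | p
  · exact (map_zero transpose).symm
  · rfl

theorem iL_eq : iL i = swapLR N * iR i * swapLR N := by
  ext1 φ; funext p q; rfl

/-- The left operators are the right ones conjugated by the involution exchanging the two factors,
which preserves all the relations. -/
theorem isCAR_left : IsCAR (wL : Fin N → _) iL := by
  have e : ∀ A B : Module.End ℝ (DCovs N), (swapLR N * A * swapLR N) * (swapLR N * B * swapLR N)
      = swapLR N * (A * B) * swapLR N := by
    intro A B
    calc _ = swapLR N * A * (swapLR N * swapLR N) * B * swapLR N := by noncomm_ring
      _ = _ := by rw [swapLR_sq]; noncomm_ring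
  constructor
  · intro j k
    rw [iL_eq, iL_eq, e, e, isCAR_right.cc j k, mul_neg, neg_mul]
  · intro j k
    rw [wL_eq, wL_eq, e, e, isCAR_right.ww j k, mul_neg, neg_mul]
  · intro j k
    rw [iL_eq, wL_eq, e, e, isCAR_right.cw j k]
    split_ifs
    · rw [mul_sub, sub_mul, mul_one, swapLR_sq]
    · rw [zero_sub, zero_sub, mul_neg, neg_mul]
  · intro j
    rw [iL_eq, e, isCAR_right.c_sq, mul_zero, zero_mul]

theorem isDoubleCAR : IsDoubleCAR (wL : Fin N → _) iL wR iR where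
  left := isCAR_left
  right := isCAR_right
  comm_ww j k := by
    ext1 φ; funext p q
    rcases p with _ | p <;> rcases q with _ | q <;>
      simp only [Module.End.mul_apply, wL_zero, wR_zero, wL_succ, wR_succ, map_zero]
    exact mapL_mapR_comm _ _ _
  comm_wc j k := by
    ext1 φ; funext p q
    rcases p with _ | p <;>
      simp only [Module.End.mul_apply, wL_zero, iR_val, wL_succ, map_zero]
    exact mapL_mapR_comm _ _ _
  comm_cw j k := by
    ext1 φ; funext p q
    rcases q with _ | q <;>
      simp only [Module.End.mul_apply, wR_zero, iL_val, wR_succ, map_zero]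
    exact mapL_mapR_comm _ _ _
  comm_cc j k := by
    ext1 φ; funext p q
    exact mapL_mapR_comm _ _ _

theorem numberR_ev (f : Fin p → Fin N) (g : Fin q → Fin N) :
    (wR i * iR i) φ p q (ev f) (ev g) = occ i g * φ p q (ev f) (ev g) := by
  rcases q with _ | q
  · simp [occ]
  · simp [mapR_apply, wedge_contract_ev]

theorem numberL_ev (f : Fin p → Fin N) (g : Fin q → Fin N) :
    (wL i * iL i) φ p q (ev f) (ev g) = occ i f * φ p q (ev f) (ev g) := by
  rcases p with _ | p
  · simp [occ]
  · have : (wL i * iL i) φ (p + 1) q (ev f) (ev g)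
      = wedge (coord i) p (contract p (bv i) (transpose (φ (p + 1) q) (ev g))) (ev f) := rfl
    rw [this, wedge_contract_ev]
    rfl

theorem sum_numberR : (∑ i, wR i * iR i) φ p q = (q : ℝ) • φ p q := by
  refine dcov_ext_ev fun f g => ?_
  simp only [LinearMap.sum_apply, DCovs.sum_apply, ContinuousAlternatingMap.sum_apply, numberR_ev,
    ContinuousAlternatingMap.smul_apply, smul_eq_mul]
  rw [← Finset.sum_mul, ← Nat.cast_sum, sum_occ]

theorem sum_numberL : (∑ i, wL i * iL i) φ p q = (p : ℝ) • φ p q := by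
  refine dcov_ext_ev fun f g => ?_
  simp only [LinearMap.sum_apply, DCovs.sum_apply, ContinuousAlternatingMap.sum_apply, numberL_ev,
    ContinuousAlternatingMap.smul_apply, smul_eq_mul]
  rw [← Finset.sum_mul, ← Nat.cast_sum, sum_occ]

theorem mapL_wedge_apply {V : Type*} [NormedAddCommGroup V] [NormedSpace ℝ V]
    (l : V →L[ℝ] ℝ) (φ : DCov V p q) (X : Fin (p + 1) → V)
    (Y : Fin q → V) : mapL q (wedge l p) φ X Y
      = ∑ a : Fin (p + 1), (-1 : ℝ) ^ (a : ℕ) * (l (X a) * φ (a.removeNth X) Y) := by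
  have : mapL q (wedge l p) φ X Y = wedge l p (transpose φ Y) X := rfl
  rw [this, wedge_apply]
  rfl

/-- Expanding the inserted vector `Xₐ` in the standard basis splits `s` into `∑ wₖ c'ₖ`. This brings
the Bianchi sum into the fermionic algebra. -/
theorem transfer_eq_bianchi : transfer wL iR φ (p + 1) q = bianchi (φ p (q + 1)) := by
  ext X Y
  rw [bianchi_apply]
  simp only [transfer, LinearMap.sum_apply, DCovs.sum_apply, ContinuousAlternatingMap.sum_apply,
    Module.End.mul_apply, wL_succ, iR_val, mapL_wedge_apply]
  rw [Finset.sum_comm]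
  refine Finset.sum_congr rfl fun a _ => ?_
  rw [← Finset.mul_sum]
  congr 1
  have := congrArg (fun γ : Alt (Fin N → ℝ) ℝ q => γ Y)
    (contract_eq_sum (X a) (φ p (q + 1) (a.removeNth X)))
  simpa [ContinuousAlternatingMap.sum_apply, mapR_apply, contract_apply] using this.symm

theorem transfer_swap : transfer wR iL = swapLR N * transfer wL iR * swapLR N := by
  simp only [transfer, Finset.mul_sum, Finset.sum_mul, wL_eq, iL_eq]
  refine Finset.sum_congr rfl fun k _ => ?_
  calc _ = (swapLR N * swapLR N) * wR k * (swapLR N * iR k * swapLR N) := by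
        rw [swapLR_sq]; noncomm_ring
    _ = swapLR N * (swapLR N * wR k * swapLR N) * iR k * swapLR N := by noncomm_ring
    _ = _ := by noncomm_ring

theorem transfer_eq_bianchiStar :
    transfer wR iL φ p (q + 1) = bianchiStar (φ (p + 1) q) := by
  rw [transfer_swap]
  change transpose (transfer wL iR (swapLR N φ) (q + 1) p) = _
  rw [transfer_eq_bianchi]
  rfl

theorem transfer_zero_right : transfer wR iL φ p 0 = 0 := by
  simp [transfer]

theorem transfer_transfer_eq :
    (transfer wR iL * transfer wL iR : Module.End ℝ (DCovs N)) φ p q = sStarS _ p q (φ p q) := by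
  rcases q with _ | q
  · exact transfer_zero_right _
  · rw [Module.End.mul_apply, transfer_eq_bianchiStar, transfer_eq_bianchi]
    rfl

end CoordinateOperators

/-! ### The extension operator on double covectors -/

section ExtensionOperator

variable {N p q : ℕ}

theorem wedge_sum {V : Type*} [NormedAddCommGroup V] [NormedSpace ℝ V] {ι : Type*}
    (s : Finset ι) (l : ι → V →L[ℝ] ℝ) (α : Alt V ℝ q) :
    wedge (∑ i ∈ s, l i) q α = ∑ i ∈ s, wedge (l i) q α := by
  ext Y
  simp only [wedge_apply, ContinuousAlternatingMap.sum_apply, sum_apply,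
    Finset.sum_mul, Finset.mul_sum]
  exact Finset.sum_comm

/-- The differential of `λ₀ + ⋯ + λ_n`. -/
def sigma (N : ℕ) : (Fin N → ℝ) →L[ℝ] ℝ := ∑ i, coord i

theorem sigma_apply (x : Fin N → ℝ) : sigma N x = ∑ i, x i := by
  simp [sigma]

/-- The operator `φ ↦ l ∧ᴸ l ∧ᴿ φ`. -/
def wedge₂ {V : Type*} [NormedAddCommGroup V] [NormedSpace ℝ V] (l : V →L[ℝ] ℝ) (p q : ℕ) :
    DCov V p q →ₗ[ℝ] DCov V (p + 1) (q + 1) :=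
  mapL (q + 1) (wedge l p) ∘ₗ mapR p (wedge l q)

theorem sum_wL_succ (φ : DCovs N) :
    (∑ i, wL i : Module.End ℝ (DCovs N)) φ (p + 1) q = mapL q (wedge (sigma N) p) (φ p q) := by
  rw [LinearMap.sum_apply, DCovs.sum_apply]
  simp only [wL_succ]
  refine dcov_ext_ev fun f g => ?_
  have h : ∀ A : Alt (Fin N → ℝ) ℝ p →L[ℝ] Alt (Fin N → ℝ) ℝ (p + 1),
      mapL q A (φ p q) (ev f) (ev g) = A (transpose (φ p q) (ev g)) (ev f) := fun A => rfl
  simp only [ContinuousAlternatingMap.sum_apply, h, sigma, wedge_sum]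

theorem sum_wR_succ (φ : DCovs N) :
    (∑ i, wR i : Module.End ℝ (DCovs N)) φ p (q + 1) = mapR p (wedge (sigma N) q) (φ p q) := by
  rw [LinearMap.sum_apply, DCovs.sum_apply]
  simp only [wR_succ]
  refine dcov_ext_ev fun f g => ?_
  simp only [ContinuousAlternatingMap.sum_apply, mapR_apply, sigma, wedge_sum]

theorem sum_wL_sum_wR (φ : DCovs N) :
    ((∑ i, wL i) * ∑ i, wR i : Module.End ℝ (DCovs N)) φ (p + 1) (q + 1)
      = wedge₂ (sigma N) p q (φ p q) := by
  rw [Module.End.mul_apply, sum_wL_succ, sum_wR_succ]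
  rfl

theorem weighted_left_ev (a : Fin N → ℝ) (φ : DCovs N) (f : Fin p → Fin N) (g : Fin q → Fin N) :
    weighted a iL wR iR φ p q (ev f) (ev g)
      = ∑ i, (a i + occ i g) * φ (p + 1) q (ev (Matrix.vecCons i f)) (ev g) := by
  simp only [weighted, LinearMap.sum_apply, DCovs.sum_apply, ContinuousAlternatingMap.sum_apply]
  refine Finset.sum_congr rfl fun i _ => ?_
  have h : ∀ ψ : DCovs N, iL i ψ p q (ev f) (ev g)
      = ψ (p + 1) q (ev (Matrix.vecCons i f)) (ev g) := by
    intro ψ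
    rw [← vecCons_ev]
    rfl
  rw [Module.End.mul_apply, h, LinearMap.add_apply, DCovs.add_apply,
    ContinuousAlternatingMap.add_apply, ContinuousAlternatingMap.add_apply, numberR_ev, add_mul]
  rfl

theorem weighted_right_ev (a : Fin N → ℝ) (φ : DCovs N) (f : Fin p → Fin N) (g : Fin q → Fin N) :
    weighted a iR wL iL φ p q (ev f) (ev g)
      = ∑ j, (a j + occ j f) * φ p (q + 1) (ev f) (ev (Matrix.vecCons j g)) := by
  simp only [weighted, LinearMap.sum_apply, DCovs.sum_apply, ContinuousAlternatingMap.sum_apply]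
  refine Finset.sum_congr rfl fun i _ => ?_
  have h : ∀ ψ : DCovs N, iR i ψ p q (ev f) (ev g)
      = ψ p (q + 1) (ev f) (ev (Matrix.vecCons i g)) := by
    intro ψ
    rw [← vecCons_ev]
    rfl
  rw [Module.End.mul_apply, h, LinearMap.add_apply, DCovs.add_apply,
    ContinuousAlternatingMap.add_apply, ContinuousAlternatingMap.add_apply, numberL_ev, add_mul]
  rfl

/-- The double covector with a single nonzero component. -/
def DCovs.single (p q : ℕ) : DCov (Fin N → ℝ) p q →ₗ[ℝ] DCovs N where
  toFun c := (Pi.single p (Pi.single q c) : ∀ p q : ℕ, DCov (Fin N → ℝ) p q)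
  map_add' b c := by
    rw [Pi.single_add, Pi.single_add]
    rfl
  map_smul' t c := by
    rw [Pi.single_smul, Pi.single_smul]
    rfl

theorem DCovs.single_same (c : DCov (Fin N → ℝ) p q) : DCovs.single p q c p q = c := by
  change (Pi.single p (Pi.single q c) : ∀ p q : ℕ, DCov (Fin N → ℝ) p q) p q = c
  rw [Pi.single_eq_same, Pi.single_eq_same]

/-- The double contraction `Aᴸ Aᴿ` with weights `a`. -/
def dcontract (a : Fin N → ℝ) (p q : ℕ) :
    DCov (Fin N → ℝ) (p + 1) (q + 1) →ₗ[ℝ] DCov (Fin N → ℝ) p q :=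
  DCovs.component p q ∘ₗ (weighted a iL wR iR * weighted a iR wL iL : Module.End ℝ (DCovs N)) ∘ₗ
    DCovs.single (p + 1) (q + 1)

theorem weighted_weighted_ev (a : Fin N → ℝ) (φ : DCovs N) (f : Fin p → Fin N)
    (g : Fin q → Fin N) :
    (weighted a iL wR iR * weighted a iR wL iL : Module.End ℝ (DCovs N)) φ p q (ev f) (ev g)
      = ∑ i, ∑ j, (a i + occ i g) * (a j + occ j (Matrix.vecCons i f))
        * φ (p + 1) (q + 1) (ev (Matrix.vecCons i f)) (ev (Matrix.vecCons j g)) := by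
  rw [Module.End.mul_apply, weighted_left_ev]
  simp only [weighted_right_ev, Finset.mul_sum, mul_assoc]

theorem dcontract_ev (a : Fin N → ℝ) (b : DCov (Fin N → ℝ) (p + 1) (q + 1)) (f : Fin p → Fin N)
    (g : Fin q → Fin N) :
    dcontract a p q b (ev f) (ev g)
      = ∑ i, ∑ j, (a i + occ i g) * (a j + occ j (Matrix.vecCons i f))
        * b (ev (Matrix.vecCons i f)) (ev (Matrix.vecCons j g)) := by
  have h := weighted_weighted_ev a (DCovs.single (p + 1) (q + 1) b) f g
  rw [DCovs.single_same] at h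
  exact h

theorem extensionOp_val (a : Fin N → ℝ) (φ : DCovs N) :
    extensionOp a wL iL wR iR φ p q = dcontract a p q (wedge₂ (sigma N) p q (φ p q)) := by
  refine dcov_ext_ev fun f g => ?_
  rw [dcontract_ev, extensionOp, Module.End.mul_apply, weighted_weighted_ev, sum_wL_sum_wR]

/-- Both `s` and `s*` commute with the extension operator, so every eigenspace of `s*s`, and hence
`Λ_m`, is preserved whatever the weights are. -/
theorem sStarS_dcontract (a : Fin N → ℝ) (c : DCov (Fin N → ℝ) p q) :
    sStarS _ p q (dcontract a p q (wedge₂ (sigma N) p q c))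
      = dcontract a p q (wedge₂ (sigma N) p q (sStarS _ p q c)) := by
  have h : (transfer wR iL * transfer wL iR) * extensionOp a wL iL wR iR
      = extensionOp a wL iL wR iR * (transfer wR iL * transfer wL iR : Module.End ℝ (DCovs N)) := by
    rw [mul_assoc, isDoubleCAR.transfer_extensionOp, ← mul_assoc,
      isDoubleCAR.transfer_extensionOp', mul_assoc]
  have h1 := congrArg (fun T : Module.End ℝ (DCovs N) => T (DCovs.single p q c) p q) h
  rw [Module.End.mul_apply, transfer_transfer_eq, extensionOp_val, DCovs.single_same,
    Module.End.mul_apply, extensionOp_val, transfer_transfer_eq, DCovs.single_same] at h1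
  exact h1

theorem wedge₂_dcontract (a : Fin N → ℝ) (c : DCov (Fin N → ℝ) p q) (t : ℝ)
    (hc : sStarS _ p q c = t • c) :
    wedge₂ (sigma N) p q (dcontract a p q (wedge₂ (sigma N) p q c))
      = ((∑ k, a k + q) * (∑ k, a k + p + 1) - t) • wedge₂ (sigma N) p q c := by
  have h := isDoubleCAR.sum_mul_extensionOp (a := a) (w := wL (N := N)) (c := iL) (w' := wR)
    (c' := iR)
  have h1 := congrArg
    (fun T : Module.End ℝ (DCovs N) => T (DCovs.single p q c) (p + 1) (q + 1)) h
  rw [Module.End.mul_apply, sum_wL_sum_wR, extensionOp_val, DCovs.single_same,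
    Module.End.mul_apply, sum_wL_sum_wR, LinearMap.sub_apply, DCovs.sub_apply,
    transfer_transfer_eq, DCovs.single_same, hc, Module.End.mul_apply, LinearMap.add_apply,
    DCovs.add_apply, sum_numberR, LinearMap.add_apply, LinearMap.add_apply,
    Module.algebraMap_end_apply, Module.algebraMap_end_apply, DCovs.smul_apply, DCovs.add_apply,
    DCovs.add_apply, sum_numberL, DCovs.smul_apply, DCovs.single_same, Module.End.one_apply,
    DCovs.single_same] at h1
  rw [h1, ← map_smul]
  congr 1
  module

theorem bianchi_bianchiStar (c : DCov (Fin N → ℝ) (p + 1) q) :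
    bianchi (bianchiStar c) = sStarS _ (p + 1) q c + ((p : ℝ) + 1 - q) • c := by
  have h1 := congrArg
    (fun T : Module.End ℝ (DCovs N) => T (DCovs.single (p + 1) q c) (p + 1) q)
    (isDoubleCAR.transfer_comm (w := wL (N := N)) (c := iL) (w' := wR) (c' := iR))
  rw [LinearMap.sub_apply, LinearMap.sub_apply, DCovs.sub_apply, DCovs.sub_apply,
    transfer_transfer_eq, Module.End.mul_apply, transfer_eq_bianchi, transfer_eq_bianchiStar,
    sum_numberR, sum_numberL, DCovs.single_same, sub_eq_iff_eq_add] at h1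
  rw [h1, Nat.cast_succ]
  module

/-- If `c` is an eigenvector with parameter `t`, then `sc` is one with parameter `t - 1` and right
degree one lower, by the commutator of `s` and `s*`. Descending, `t > q` forces `sc = 0`. The
eigenvalue is positive in this range, so `c = 0`. -/
theorem eq_zero_of_sStarS_eq : ∀ (q p : ℕ) (t : ℝ) (c : DCov (Fin N → ℝ) p q), (q : ℝ) < t →
    sStarS _ p q c = (t * (t + p - q + 1)) • c → c = 0
  | 0, p, t, c, ht, hc => by
    have h : (t * (t + p - (0 : ℕ) + 1)) • c = 0 := hc.symm
    refine (smul_eq_zero.mp h).resolve_left ?_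
    push_cast at ht ⊢
    have : (0 : ℝ) ≤ p := by positivity
    exact (by nlinarith : (0 : ℝ) < t * (t + p - 0 + 1)).ne'
  | q + 1, p, t, c, ht, hc => by
    have hs : bianchiStar (bianchi c) = (t * (t + p - (q + 1 : ℕ) + 1)) • c := hc
    push_cast at hs ht
    have h0 : bianchi c = 0 := by
      refine eq_zero_of_sStarS_eq q (p + 1) (t - 1) (bianchi c) (by linarith) ?_
      have h := bianchi_bianchiStar (bianchi c)
      rw [hs, map_smul] at h
      rw [← sub_eq_iff_eq_add.mpr h]
      push_cast
      module
    rw [h0, map_zero] at hs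
    refine (smul_eq_zero.mp hs.symm).resolve_left ?_
    have : (0 : ℝ) ≤ p := by positivity
    have : (0 : ℝ) ≤ q := by positivity
    exact (mul_pos (by linarith) (by linarith)).ne'

theorem mem_summand_iff {V : Type*} [NormedAddCommGroup V] [NormedSpace ℝ V] {m : ℤ}
    (hm : 0 ≤ m) (c : DCov V p q) :
    c ∈ summand V p q m ↔ sStarS V p q c = ((m : ℝ) * (m + p - q + 1)) • c := by
  rw [summand, if_pos hm]
  rfl

theorem summand_eq_zero {m : ℤ} (c : DCov (Fin N → ℝ) p q) (hc : c ∈ summand _ p q m)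
    (h : m < 0 ∨ (q : ℤ) < m) : c = 0 := by
  by_cases hm : 0 ≤ m
  · rw [mem_summand_iff hm] at hc
    refine eq_zero_of_sStarS_eq q p m c ?_ hc
    exact_mod_cast h.resolve_left (by omega)
  · rw [summand, if_neg hm] at hc
    simpa using hc

end ExtensionOperator

/-! ### Naturality of the operators under pullback, and the kernel of exterior multiplication on
both sides. -/

section Pullback

variable {V W : Type*} [NormedAddCommGroup V] [NormedSpace ℝ V]
  [NormedAddCommGroup W] [NormedSpace ℝ W] {p q : ℕ}

/-- Pullback as a linear map. -/
def pullₗ (A : W →L[ℝ] V) (p q : ℕ) : DCov V p q →ₗ[ℝ] DCov W p q where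
  toFun := pull A
  map_add' _ _ := rfl
  map_smul' _ _ := rfl

theorem bianchi_pull (A : W →L[ℝ] V) (φ : DCov V p (q + 1)) :
    bianchi (pull A φ) = pull A (bianchi φ) := by
  ext X Y
  rw [pull_apply, bianchi_apply, bianchi_apply]
  refine Finset.sum_congr rfl fun a _ => ?_
  rw [pull_apply]
  congr 2
  funext b
  refine Fin.cases rfl (fun b => rfl) b

theorem bianchiStar_pull (A : W →L[ℝ] V) (φ : DCov V (p + 1) q) :
    bianchiStar (pull A φ) = pull A (bianchiStar φ) := by
  change transpose (bianchi (pull A (transpose φ))) = _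
  rw [bianchi_pull]
  rfl

theorem sStarS_pull (A : W →L[ℝ] V) (φ : DCov V p q) :
    sStarS W p q (pull A φ) = pull A (sStarS V p q φ) := by
  rcases q with _ | q
  · exact (map_zero (pullₗ A p 0)).symm
  · change bianchiStar (bianchi (pull A φ)) = _
    rw [bianchi_pull, bianchiStar_pull]
    rfl

theorem pull_mem_summand (A : W →L[ℝ] V) {m : ℤ} {φ : DCov V p q} (h : φ ∈ summand V p q m) :
    pull A φ ∈ summand W p q m := by
  by_cases hm : 0 ≤ m
  · rw [mem_summand_iff hm] at h ⊢
    rw [sStarS_pull, h]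
    rfl
  · rw [summand, if_neg hm, Submodule.mem_bot] at h ⊢
    rw [h]
    exact map_zero (pullₗ A p q)

theorem wedge_pull (A : W →L[ℝ] V) (l : V →L[ℝ] ℝ) (α : Alt V ℝ q) :
    wedge (l ∘L A) q (α.compContinuousLinearMap A)
      = (wedge l q α).compContinuousLinearMap A := by
  ext Y
  rw [wedge_apply, ContinuousAlternatingMap.compContinuousLinearMap_apply, wedge_apply]
  rfl

theorem wedge₂_pull (A : W →L[ℝ] V) (l : V →L[ℝ] ℝ) (φ : DCov V p q) :
    wedge₂ (l ∘L A) p q (pull A φ) = pull A (wedge₂ l p q φ) := by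
  have hR : mapR p (wedge (l ∘L A) q) (pull A φ) = pull A (mapR p (wedge l q) φ) := by
    apply ContinuousAlternatingMap.ext
    intro X
    exact wedge_pull A l (φ fun a => A (X a))
  change mapL (q + 1) (wedge (l ∘L A) p) (mapR p (wedge (l ∘L A) q) (pull A φ)) = _
  rw [hR]
  ext X Y
  have := wedge_pull A l (transpose (mapR p (wedge l q) φ) fun b => A (Y b))
  exact congrArg (fun γ : Alt W ℝ (p + 1) => γ X) this

/-- Together with the converse below, this says that `l ∧ᴸ l ∧ᴿ φ` carries exactly the information
of `φ` restricted to `ker l`. It is used for `dσ` (the tangent space of the simplex) and for `ν`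
(that of the sphere). -/
theorem eq_zero_of_wedge₂_eq_zero (l : V →L[ℝ] ℝ) (z : V) (hz : l z = 1) (φ : DCov V p q)
    (h : wedge₂ l p q φ = 0) (X : Fin p → V) (Y : Fin q → V) (hX : ∀ a, l (X a) = 0)
    (hY : ∀ b, l (Y b) = 0) : φ X Y = 0 := by
  refine wedge_eq_zero_imp l z hz (φ X) ?_ Y hY
  ext Y'
  refine wedge_eq_zero_imp l z hz (transpose (mapR p (wedge l q) φ) Y') ?_ X hX
  ext X'
  exact congrArg (fun γ : DCov V (p + 1) (q + 1) => γ X' Y') h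

theorem wedge₂_eq_zero_of_ker (l : V →L[ℝ] ℝ) (z : V) (hz : l z = 1) (φ : DCov V p q)
    (h : ∀ (X : Fin p → V) (Y : Fin q → V), (∀ a, l (X a) = 0) → (∀ b, l (Y b) = 0) →
      φ X Y = 0) : wedge₂ l p q φ = 0 := by
  ext X Y
  change wedge l p (transpose (mapR p (wedge l q) φ) Y) X = 0
  rw [wedge_eq_zero_of_ker l z hz]
  · rfl
  · intro X' hX'
    change wedge l q (φ X') Y = 0
    rw [wedge_eq_zero_of_ker l z hz _ fun Y' hY' => h X' Y' hX' hY']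
    rfl

end Pullback

/-! ### The Hodge star -/

section Hodge

variable {N p j : ℕ}

theorem volContract_apply (h : p + j = N) (f : Fin p → Fin N) (Y : Fin j → Fin N → ℝ) :
    volContract h f Y = Matrix.det (Matrix.of fun a : Fin N =>
      Fin.append (ev f) Y (Fin.cast h.symm a)) := rfl

theorem contract_volContract (h : p + (j + 1) = N) (h' : p + 1 + j = N) (f : Fin p → Fin N)
    (i : Fin N) :
    contract j (bv i) (volContract h f) = volContract h' (Fin.snoc f i : Fin (p + 1) → Fin N) := by
  ext Y
  rw [contract_apply, volContract_apply, volContract_apply]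
  congr 2
  funext a
  have e : (ev (Fin.snoc f i : Fin (p + 1) → Fin N)) = Fin.snoc (ev f) (bv i) := by
    funext k
    refine Fin.lastCases ?_ (fun k => ?_) k
    · simp [ev]
    · simp [ev]
  have := Fin.append_right_cons (ev f) (bv i) Y
  rw [e]
  change Fin.append (ev f) (Fin.cons (bv i) Y : Fin (j + 1) → Fin N → ℝ) _ = _
  rw [this]
  rfl

/-- Cramer's rule, as the exterior product of a coordinate covector with an iterated contraction
of the volume form. -/
theorem wedge_volContract (k : Fin N) : ∀ (p j : ℕ) (h : p + 1 + j = N) (h' : p + (j + 1) = N)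
    (f : Fin (p + 1) → Fin N), wedge (coord k) j (volContract h f)
      = ∑ b : Fin (p + 1), ((-1 : ℝ) ^ (p + (b : ℕ)) * if f b = k then 1 else 0) •
          volContract h' (b.removeNth f)
  | p, j, h, h', f => by
    have hs : f = (Fin.snoc (Fin.init f) (f (Fin.last p)) : Fin (p + 1) → Fin N) :=
      (Fin.snoc_init_self f).symm
    have h1 : volContract h f
        = contract j (bv (f (Fin.last p))) (volContract h' (Fin.init f)) := by
      rw [contract_volContract h' h, ← hs]
    have h2 := contract_wedge (coord k) (bv (f (Fin.last p))) (volContract h' (Fin.init f))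
    rw [← h1, coord_bv] at h2
    rw [Fin.sum_univ_castSucc]
    have h3 : (Fin.last p).removeNth f = Fin.init f := by
      funext a
      simp [Fin.removeNth, Fin.init]
    rw [h3]
    have h4 : ((-1 : ℝ) ^ (p + ((Fin.last p : Fin (p + 1)) : ℕ))) = 1 := by
      rw [Fin.val_last]
      exact Even.neg_one_pow (by simp)
    rw [h4, one_mul, ← sub_eq_iff_eq_add, ← neg_inj, neg_sub, ← h2]
    match p, h, h', f with
    | 0, h, h', f =>
      -- Here `volContract` without inserted basis vectors is a form of top degree, so its exterior
      -- product with a covector vanishes.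
      rw [alt_eq_zero_of_lt (wedge (coord k) (j + 1) _) (by omega)]
      simp
    | p + 1, h, h', f =>
      rw [wedge_volContract k p (j + 1) (by omega) (by omega), map_sum, ← Finset.sum_neg_distrib]
      refine Finset.sum_congr rfl fun b _ => ?_
      rw [map_smul, contract_volContract (by omega : p + (j + 1 + 1) = N) h', ← neg_smul]
      have e1 : (Fin.snoc (b.removeNth (Fin.init f)) (f (Fin.last (p + 1))) : Fin (p + 1) → Fin N)
          = b.castSucc.removeNth f := by
        funext a
        refine Fin.lastCases ?_ (fun a => ?_) a
        · simp [Fin.removeNth]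
        · simp [Fin.removeNth, Fin.init]
      rw [e1]
      congr 1
      have : Fin.init f b = f b.castSucc := rfl
      rw [this, Fin.val_castSucc]
      ring

theorem hodge_apply (h : p + j = N) (α : Alt (Fin N → ℝ) ℝ p) :
    hodge N p j α = ((Nat.factorial p : ℝ)⁻¹) •
      ∑ f : Fin p → Fin N, α (ev f) • volContract h f := by
  rw [hodge, dif_pos h]
  simp only [smul_apply, sum_apply]
  rfl

theorem sum_removeNth {M : Type*} [AddCommMonoid M] (b : Fin (p + 1)) (k : Fin N)
    (G : (Fin p → Fin N) → M) :
    ∑ f : Fin (p + 1) → Fin N, (if f b = k then G (b.removeNth f) else 0) = ∑ f, G f := by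
  rw [← (Fin.insertNthEquiv (fun _ => Fin N) b).sum_comp, Fintype.sum_prod_type]
  simp [Fin.insertNthEquiv]

/-- Cramer's rule moves the coordinate covector from the output of the star to its input, where it
selects the components of `β` with one index equal to `k`. These form the contraction with `e_k`. -/
theorem wedge_hodge (h : p + 1 + j = N) (k : Fin N) (β : Alt (Fin N → ℝ) ℝ (p + 1)) :
    wedge (coord k) j (hodge N (p + 1) j β)
      = (-1 : ℝ) ^ p • hodge N p (j + 1) (contract p (bv k) β) := by
  have h' : p + (j + 1) = N := by omega
  rw [hodge_apply h, hodge_apply h', map_smul, map_sum]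
  have e : ∀ f : Fin (p + 1) → Fin N, wedge (coord k) j (β (ev f) • volContract h f)
      = ∑ b : Fin (p + 1), if f b = k then (-1 : ℝ) ^ p •
        (contract p (bv k) β (ev (b.removeNth f)) • volContract h' (b.removeNth f)) else 0 := by
    intro f
    rw [map_smul, wedge_volContract k p j h h', Finset.smul_sum]
    refine Finset.sum_congr rfl fun b _ => ?_
    split_ifs with hb
    · have h1 := alt_vecCons_removeNth β b (bv k) (ev f) (by rw [← hb]; rfl)
      rw [contract_apply, ← removeNth_ev, h1, smul_smul, smul_smul]
      congr 1
      ring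
    · simp
  simp only [e]
  rw [Finset.sum_comm]
  simp only [sum_removeNth _ k
    (fun f => (-1 : ℝ) ^ p • (contract p (bv k) β (ev f) • volContract h' f))]
  -- The `p + 1` positions of the index `k` contribute equally, which turns `1/(p+1)!` into `1/p!`.
  rw [Finset.sum_const, Finset.card_univ, Fintype.card_fin, ← Finset.smul_sum,
    ← Nat.cast_smul_eq_nsmul ℝ, smul_smul, smul_comm ((-1 : ℝ) ^ p), smul_smul, smul_smul]
  congr 1
  rw [Nat.factorial_succ]
  push_cast
  have h1 : (p : ℝ) + 1 ≠ 0 := by positivity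
  have h2 : (Nat.factorial p : ℝ) ≠ 0 := by positivity
  field_simp

/-- If `⋆β = 0`, then `⋆` annihilates every contraction `e_k ⌟ β`, by `wedge_hodge`. Induction on
the degree ends with scalars times the volume form. -/
theorem hodge_injective : ∀ (p j : ℕ) (_ : p + j = N) (β : Alt (Fin N → ℝ) ℝ p),
    hodge N p j β = 0 → β = 0
  | 0, j, h, β, hβ => by
    obtain rfl : j = N := by omega
    rw [hodge_apply h] at hβ
    have h1 := congrArg (fun γ : Alt (Fin j → ℝ) ℝ j => γ (ev id)) hβ
    simp only [Nat.factorial_zero, Nat.cast_one, inv_one, one_smul, Finset.univ_unique,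
      Finset.sum_singleton, ContinuousAlternatingMap.smul_apply, volContract_apply] at h1
    have h2 : (Matrix.of fun a : Fin j =>
        Fin.append (ev (default : Fin 0 → Fin j)) (ev id) (Fin.cast h.symm a)) = 1 := by
      rw [Fin.append_left_nil _ _ rfl]
      funext a b
      simp [ev, Matrix.one_apply, Pi.single_apply, eq_comm, Fin.ext_iff]
    rw [h2, Matrix.det_one, smul_eq_mul, mul_one] at h1
    refine alt_ext_ev fun f => ?_
    rw [Subsingleton.elim f default]
    exact h1
  | p + 1, j, h, β, hβ => by
    have h1 : ∀ k, contract p (bv k) β = 0 := by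
      intro k
      refine hodge_injective p (j + 1) (by omega) _ ?_
      have h2 := wedge_hodge h k β
      rw [hβ, map_zero, eq_comm, smul_eq_zero] at h2
      exact h2.resolve_left (pow_ne_zero _ (by norm_num))
    refine alt_ext_contract fun x => ?_
    rw [contract_eq_sum x β]
    simp [h1]

theorem tensorMap_injective {V : Type*} [NormedAddCommGroup V] [NormedSpace ℝ V] {q p' q' : ℕ}
    (A : Alt V ℝ p →L[ℝ] Alt V ℝ p') (B : Alt V ℝ q →L[ℝ] Alt V ℝ q')
    (hA : Function.Injective A) (hB : Function.Injective B) :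
    Function.Injective (tensorMap A B : DCov V p q → DCov V p' q') := by
  intro φ ψ h
  apply ContinuousAlternatingMap.ext
  intro X
  apply hB
  ext Y
  have h1 : transpose (mapR p B φ) Y = transpose (mapR p B ψ) Y :=
    hA (by ext X'; exact congrArg (fun γ : DCov V p' q' => γ X' Y) h)
  exact congrArg (fun γ : Alt V ℝ p => γ X) h1

end Hodge

/-! ### Polynomial coefficients -/

section Polynomials

open MvPolynomial

variable {N p q r : ℕ}

/-- The coordinate map is injective, so a left inverse expresses every linear functional as a
combination of components. Properties of the components thus pass to all functionals. -/
theorem mem_of_ev {ι : Type*} (S : Submodule ℝ (ι → ℝ)) (ψ : ι → DCov (Fin N → ℝ) p q)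
    (h : ∀ (f : Fin p → Fin N) (g : Fin q → Fin N), (fun x => ψ x (ev f) (ev g)) ∈ S)
    (l : DCov (Fin N → ℝ) p q →ₗ[ℝ] ℝ) : (fun x => l (ψ x)) ∈ S := by
  let L : DCov (Fin N → ℝ) p q →ₗ[ℝ] ((Fin p → Fin N) × (Fin q → Fin N) → ℝ) :=
    { toFun := fun φ k => φ (ev k.1) (ev k.2)
      map_add' := fun _ _ => rfl
      map_smul' := fun _ _ => rfl }
  obtain ⟨K, hK⟩ := L.exists_leftInverse_of_injective (LinearMap.ker_eq_bot.mpr fun φ ψ h =>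
    dcov_ext_ev fun f g => congrFun h (f, g))
  have e : (fun x => l (ψ x)) = ∑ k, l (K fun j => if k = j then 1 else 0) •
      fun x => ψ x (ev k.1) (ev k.2) := by
    funext x
    have h1 : l (ψ x) = (l ∘ₗ K) (L (ψ x)) := by
      rw [LinearMap.comp_apply, ← LinearMap.comp_apply K L, hK, LinearMap.id_apply]
    rw [h1, LinearMap.pi_apply_eq_sum_univ, Finset.sum_apply]
    exact Finset.sum_congr rfl fun k _ => mul_comm _ _
  rw [e]
  exact Submodule.sum_mem _ fun k _ => S.smul_mem _ (h k.1 k.2)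

/-- The exponents of the monomials of degree `r` in `N` variables. -/
def expo (N r : ℕ) : Finset (Fin N →₀ ℕ) := Finset.finsuppAntidiag Finset.univ r

theorem mem_expo (a : Fin N →₀ ℕ) : a ∈ expo N r ↔ ∑ i, a i = r := by
  simp [expo]

theorem isHomogeneous_monomial_expo {a : Fin N →₀ ℕ} (ha : a ∈ expo N r) (t : ℝ) :
    (monomial a t).IsHomogeneous r := by
  refine isHomogeneous_monomial t ?_
  rw [Finsupp.degree_eq_sum]
  exact (mem_expo a).mp ha

theorem eval_eq_sum_expo {f : MvPolynomial (Fin N) ℝ} (hf : f.IsHomogeneous r)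
    (x : Fin N → ℝ) : eval x f = ∑ a ∈ expo N r, (∏ i, x i ^ a i) * coeff a f := by
  rw [eval_eq']
  rw [Finset.sum_subset (s₂ := expo N r)]
  · exact Finset.sum_congr rfl fun a _ => mul_comm _ _
  · intro a ha
    rw [mem_expo, ← Finsupp.degree_eq_sum]
    by_contra hc
    exact (mem_support_iff.mp ha) (hf.coeff_eq_zero hc)
  · intro a _ ha
    rw [notMem_support_iff.mp ha, zero_mul]

theorem eval_smul_of_isHomogeneous {f : MvPolynomial (Fin N) ℝ} (hf : f.IsHomogeneous r)
    (t : ℝ) (x : Fin N → ℝ) : eval (t • x) f = t ^ r * eval x f := by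
  rw [eval_eq_sum_expo hf, eval_eq_sum_expo hf, Finset.mul_sum]
  refine Finset.sum_congr rfl fun a ha => ?_
  rw [← (mem_expo a).mp ha, ← Finset.prod_pow_eq_pow_sum, ← mul_assoc, ← Finset.prod_mul_distrib]
  simp [mul_pow]

theorem eq_zero_of_eval_pos {f : MvPolynomial (Fin N) ℝ}
    (h : ∀ x : Fin N → ℝ, (∀ i, 0 < x i) → eval x f = 0) : f = 0 := by
  refine funext_set (fun _ => Set.Ioi (0 : ℝ)) (fun _ => Set.Ioi_infinite 0) fun x hx => ?_
  rw [h x fun i => hx i trivial, map_zero]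

theorem eq_zero_of_eval_stdSimplex {n : ℕ} {f : MvPolynomial (Fin (n + 1)) ℝ}
    (hf : f.IsHomogeneous r)
    (h : ∀ x ∈ stdSimplex ℝ (Fin (n + 1)), eval x f = 0) : f = 0 := by
  refine eq_zero_of_eval_pos fun x hx => ?_
  have hs : 0 < ∑ i, x i := Finset.sum_pos (fun i _ => hx i) Finset.univ_nonempty
  have e : x = (∑ i, x i) • ((∑ i, x i)⁻¹ • x) := by
    rw [smul_smul, mul_inv_cancel₀ hs.ne', one_smul]
  rw [e, eval_smul_of_isHomogeneous hf, h, mul_zero]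
  refine ⟨fun i => mul_nonneg (inv_nonneg.mpr hs.le) (hx i).le, ?_⟩
  simp only [Pi.smul_apply, smul_eq_mul]
  rw [← Finset.mul_sum, inv_mul_cancel₀ hs.ne']

/-- The double form `∑ₐ xᵃ cₐ`, summed over the exponents `a` of degree `r`. -/
def homForm (r : ℕ) (c : (Fin N →₀ ℕ) → DCov (Fin N → ℝ) p q) (x : Fin N → ℝ) :
    DCov (Fin N → ℝ) p q := ∑ a ∈ expo N r, (∏ i, x i ^ a i) • c a

/-- The coefficients of `homForm`, as polynomials. -/
def homPoly (r : ℕ) (c : (Fin N →₀ ℕ) → ℝ) : MvPolynomial (Fin N) ℝ :=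
  ∑ a ∈ expo N r, monomial a (c a)

theorem isHomogeneous_homPoly (c : (Fin N →₀ ℕ) → ℝ) : (homPoly r c).IsHomogeneous r :=
  IsHomogeneous.sum _ _ _ fun _ ha => isHomogeneous_monomial_expo ha _

theorem eval_homPoly (c : (Fin N →₀ ℕ) → ℝ) (x : Fin N → ℝ) :
    eval x (homPoly r c) = ∑ a ∈ expo N r, (∏ i, x i ^ a i) * c a := by
  simp only [homPoly, map_sum, eval_monomial, Finsupp.prod_pow]
  exact Finset.sum_congr rfl fun a _ => mul_comm _ _

theorem coeff_homPoly (c : (Fin N →₀ ℕ) → ℝ) {a : Fin N →₀ ℕ} (ha : a ∈ expo N r) :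
    coeff a (homPoly r c) = c a := by
  simp only [homPoly, coeff_sum, coeff_monomial]
  rw [Finset.sum_eq_single a]
  · simp
  · intro b _ hb
    rw [if_neg hb]
  · exact fun h => absurd ha h

theorem homForm_apply (c : (Fin N →₀ ℕ) → DCov (Fin N → ℝ) p q) (x : Fin N → ℝ)
    (X : Fin p → Fin N → ℝ) (Y : Fin q → Fin N → ℝ) :
    homForm r c x X Y = eval x (homPoly r fun a => c a X Y) := by
  simp [eval_homPoly, homForm, ContinuousAlternatingMap.sum_apply]

/-- Homogeneous polynomials that agree on the simplex agree on the positive orthant by scaling,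
hence are equal. Pointwise statements on the simplex therefore become statements about coefficients.
-/
theorem homForm_unique {n : ℕ} (c c' : (Fin (n + 1) →₀ ℕ) → DCov (Fin (n + 1) → ℝ) p q)
    (h : ∀ x ∈ stdSimplex ℝ (Fin (n + 1)), homForm r c x = homForm r c' x)
    {a : Fin (n + 1) →₀ ℕ} (ha : a ∈ expo (n + 1) r) : c a = c' a := by
  refine dcov_ext_ev fun f g => ?_
  have h1 : homPoly r (fun a => c a (ev f) (ev g)) - homPoly r (fun a => c' a (ev f) (ev g))
      = 0 := by
    refine eq_zero_of_eval_stdSimplex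
      ((isHomogeneous_homPoly _).sub (isHomogeneous_homPoly _)) fun x hx => ?_
    rw [map_sub, ← homForm_apply, ← homForm_apply, h x hx, sub_self]
  rw [← coeff_homPoly (fun a => c a (ev f) (ev g)) ha, sub_eq_zero.mp h1, coeff_homPoly _ ha]

/-- Evaluation of polynomials at a family of points. -/
def evalAt {ι : Type*} (pt : ι → Fin N → ℝ) : MvPolynomial (Fin N) ℝ →ₗ[ℝ] (ι → ℝ) where
  toFun P x := eval (pt x) P
  map_add' P Q := by funext x; simp
  map_smul' t P := by funext x; simp [smul_eval]

theorem exists_eval_functional {ι : Type*} (S : Submodule ℝ (MvPolynomial (Fin N) ℝ))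
    (pt : ι → Fin N → ℝ) (ψ : ι → DCov (Fin N → ℝ) p q)
    (h : ∀ (f : Fin p → Fin N) (g : Fin q → Fin N), ∃ P ∈ S,
      ∀ x, ψ x (ev f) (ev g) = eval (pt x) P) (l : DCov (Fin N → ℝ) p q →ₗ[ℝ] ℝ) :
    ∃ P ∈ S, ∀ x, l (ψ x) = eval (pt x) P := by
  have h0 : ∀ (f : Fin p → Fin N) (g : Fin q → Fin N),
      (fun x => ψ x (ev f) (ev g)) ∈ S.map (evalAt pt) := by
    intro f g
    obtain ⟨P, hP, hx⟩ := h f g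
    have e : (fun x => ψ x (ev f) (ev g)) = evalAt pt P := funext hx
    rw [e]
    exact Submodule.mem_map_of_mem hP
  have h1 := mem_of_ev (S.map (evalAt pt)) ψ h0 l
  obtain ⟨P, hP, hx⟩ := Submodule.mem_map.mp h1
  exact ⟨P, hP, fun x => (congrFun hx x).symm⟩

/-- Double covectors depending on a parameter, with coefficients in a space of polynomials, are a
combination of finitely many constant double covectors with coefficients in that space. -/
theorem exists_eval_comb {ι : Type*} (S : Submodule ℝ (MvPolynomial (Fin N) ℝ))
    (pt : ι → Fin N → ℝ) (ψ : ι → DCov (Fin N → ℝ) p q)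
    (h : ∀ (f : Fin p → Fin N) (g : Fin q → Fin N), ∃ P ∈ S,
      ∀ x, ψ x (ev f) (ev g) = eval (pt x) P) :
    ∃ (k : ℕ) (P : Fin k → MvPolynomial (Fin N) ℝ) (b : Fin k → DCov (Fin N → ℝ) p q),
      (∀ j, P j ∈ S) ∧ (∀ x, ψ x = ∑ j, eval (pt x) (P j) • b j) ∧
        ∀ x j, ψ x = 0 → eval (pt x) (P j) = 0 := by
  obtain ⟨k, ⟨b⟩⟩ : ∃ k, Nonempty (Module.Basis (Fin k) ℝ (DCov (Fin N → ℝ) p q)) :=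
    ⟨_, ⟨Module.finBasis ℝ _⟩⟩
  choose P hP hx using fun j => exists_eval_functional S pt ψ h (b.coord j)
  refine ⟨k, P, b, hP, fun x => ?_, fun x j h0 => by rw [← hx j x, h0, map_zero]⟩
  rw [← b.sum_repr (ψ x)]
  exact Finset.sum_congr rfl fun j _ => by rw [← hx j x, Module.Basis.coord_apply]

/-- Double covectors depending on a parameter, with homogeneous polynomial coefficients, have an
expansion into monomials. -/
theorem exists_homForm {ι : Type*} (pt : ι → Fin N → ℝ) (ψ : ι → DCov (Fin N → ℝ) p q)
    (h : ∀ (f : Fin p → Fin N) (g : Fin q → Fin N), ∃ P : MvPolynomial (Fin N) ℝ,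
      P.IsHomogeneous r ∧ ∀ x, ψ x (ev f) (ev g) = eval (pt x) P) :
    ∃ c : (Fin N →₀ ℕ) → DCov (Fin N → ℝ) p q, ∀ x, ψ x = homForm r c (pt x) := by
  obtain ⟨k, P, b, hP, hx, -⟩ := exists_eval_comb (homogeneousSubmodule (Fin N) ℝ r) pt ψ h
  refine ⟨fun a => ∑ j, coeff a (P j) • b j, fun x => ?_⟩
  rw [hx, homForm]
  simp only [Finset.smul_sum]
  rw [Finset.sum_comm]
  refine Finset.sum_congr rfl fun j _ => ?_
  rw [eval_eq_sum_expo (hP j), Finset.sum_smul]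
  exact Finset.sum_congr rfl fun a _ => mul_smul _ _ _

/-- The double form with polynomial coefficients `h k` with respect to the covectors `b k`. -/
def polyComb {κ : Type*} [Fintype κ] (h : κ → MvPolynomial (Fin N) ℝ)
    (b : κ → DCov (Fin N → ℝ) p q) (x : Fin N → ℝ) : DCov (Fin N → ℝ) p q :=
  ∑ k, eval x (h k) • b k

theorem exists_polyComb (ψ : (Fin N → ℝ) → DCov (Fin N → ℝ) p q)
    (h : ∀ (f : Fin p → Fin N) (g : Fin q → Fin N), ∃ P : MvPolynomial (Fin N) ℝ,
      ∀ x, ψ x (ev f) (ev g) = eval x P) :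
    ∃ (k : ℕ) (h : Fin k → MvPolynomial (Fin N) ℝ) (b : Fin k → DCov (Fin N → ℝ) p q),
      ψ = polyComb h b ∧ ∀ x j, ψ x = 0 → eval x (h j) = 0 := by
  obtain ⟨k, P, b, -, hx, h0⟩ := exists_eval_comb ⊤ id ψ
    fun f g => (h f g).imp fun P hP => ⟨trivial, hP⟩
  exact ⟨k, P, b, funext hx, h0⟩

theorem polyComb_apply {κ : Type*} [Fintype κ] (h : κ → MvPolynomial (Fin N) ℝ)
    (b : κ → DCov (Fin N → ℝ) p q) (x : Fin N → ℝ) (X : Fin p → Fin N → ℝ)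
    (Y : Fin q → Fin N → ℝ) :
    polyComb h b x X Y = eval x (∑ k, C (b k X Y) * h k) := by
  simp [polyComb, ContinuousAlternatingMap.sum_apply, mul_comm]

theorem polyComb_mem_polyForm {n : ℕ} {κ : Type*} [Fintype κ]
    (h : κ → MvPolynomial (Fin (n + 1)) ℝ) (b : κ → DCov (Fin (n + 1) → ℝ) p q) :
    polyComb h b ∈ PolyForm n p q :=
  fun X Y => ⟨_, fun x => polyComb_apply h b x X Y⟩

theorem map_polyComb {M : Type*} [AddCommGroup M] [Module ℝ M] {κ : Type*} [Fintype κ]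
    (T : DCov (Fin N → ℝ) p q →ₗ[ℝ] M) (h : κ → MvPolynomial (Fin N) ℝ)
    (b : κ → DCov (Fin N → ℝ) p q) (x : Fin N → ℝ) :
    T (polyComb h b x) = ∑ k, eval x (h k) • T (b k) := by
  simp [polyComb]

/-- Substitution of zero for the `i`-th variable. -/
def setZero (i : Fin N) : MvPolynomial (Fin N) ℝ →ₐ[ℝ] MvPolynomial (Fin N) ℝ :=
  aeval fun j => if j = i then 0 else X j

theorem setZero_X (i j : Fin N) : setZero i (X j) = if j = i then 0 else X j :=
  aeval_X _ _

theorem eval_setZero (i : Fin N) (f : MvPolynomial (Fin N) ℝ) (u : Fin N → ℝ) :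
    eval u (setZero i f) = eval (Function.update u i 0) f := by
  have h2 : (eval u).comp (setZero i).toRingHom = eval (Function.update u i 0) := by
    refine MvPolynomial.ringHom_ext (fun c => by simp [setZero]) fun j => ?_
    by_cases hj : j = i
    · subst hj; simp [setZero_X]
    · simp [setZero_X, hj]
  exact congrArg (fun φ : MvPolynomial (Fin N) ℝ →+* ℝ => φ f) h2

theorem setZero_eq_zero {i : Fin N} {f : MvPolynomial (Fin N) ℝ}
    (h : ∀ u : Fin N → ℝ, u i = 0 → (∀ j, j ≠ i → 0 < u j) → eval u f = 0) :
    setZero i f = 0 := by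
  refine eq_zero_of_eval_pos fun u hu => ?_
  rw [eval_setZero]
  exact h _ (by simp) fun j hj => by simpa [hj] using hu j

theorem X_dvd_of_eval (i : Fin N) (f : MvPolynomial (Fin N) ℝ)
    (h : ∀ u : Fin N → ℝ, u i = 0 → eval u f = 0) : X i ∣ f := by
  have h1 : setZero i f = 0 := setZero_eq_zero fun u hu _ => h u hu
  -- Modulo `Xᵢ`, setting the `i`-th variable to zero changes nothing, since both maps agree on the
  -- variables.
  have h4 : Ideal.Quotient.mkₐ ℝ (Ideal.span {(X i : MvPolynomial (Fin N) ℝ)})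
      = (Ideal.Quotient.mkₐ ℝ (Ideal.span {(X i : MvPolynomial (Fin N) ℝ)})).comp
        (setZero i) := by
    refine MvPolynomial.algHom_ext fun j => ?_
    by_cases hj : j = i
    · subst hj
      simp [setZero_X]
    · simp [setZero_X, hj]
  rw [← Ideal.mem_span_singleton, ← Ideal.Quotient.eq_zero_iff_mem]
  have h5 := AlgHom.congr_fun h4 f
  rw [AlgHom.comp_apply, h1, map_zero] at h5
  exact h5

theorem prod_X_dvd (f : MvPolynomial (Fin N) ℝ)
    (h : ∀ (i : Fin N) (u : Fin N → ℝ), u i = 0 → eval u f = 0) : ∏ i, X i ∣ f := by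
  refine Finset.prod_dvd_of_isRelPrime ?_ fun i _ => X_dvd_of_eval i f (h i)
  intro i _ j _ hij
  refine (X_prime.irreducible.isRelPrime_iff_not_dvd).mpr ?_
  rw [X_dvd_X]
  exact hij

theorem hasFDerivAt_eval (f : MvPolynomial (Fin N) ℝ) (u : Fin N → ℝ) :
    HasFDerivAt (fun x => eval x f) (∑ i, eval u (pderiv i f) • coord i) u := by
  induction f using MvPolynomial.induction_on with
  | C c => simpa using hasFDerivAt_const c u
  | add f g hf hg =>
    have h := hf.add hg
    simp only [map_add, add_smul, Finset.sum_add_distrib]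
    exact h
  | mul_X f j hf =>
    have h := hf.mul (coord j).hasFDerivAt
    have e : (∑ i, eval u (pderiv i (f * X j)) • coord i : (Fin N → ℝ) →L[ℝ] ℝ)
        = eval u f • coord j + (coord j u) • ∑ i, eval u (pderiv i f) • coord i := by
      simp only [pderiv_mul, pderiv_X, map_add, map_mul, eval_X, add_smul, Finset.sum_add_distrib,
        Finset.smul_sum, smul_smul]
      rw [add_comm]
      congr 1
      · rw [Finset.sum_eq_single j]
        · simp
        · intro b _ hb
          simp [hb.symm]
        · simp
      · refine Finset.sum_congr rfl fun i _ => ?_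
        rw [mul_comm]
        rfl
    have e2 : (fun x => eval x (f * X j)) = (fun x => eval x f) * ⇑(coord j) := by
      funext x
      simp
    rw [e, e2]
    exact h

theorem hasFDerivAt_polyComb {κ : Type*} [Fintype κ] (h : κ → MvPolynomial (Fin N) ℝ)
    (b : κ → DCov (Fin N → ℝ) p q) (u : Fin N → ℝ) :
    HasFDerivAt (polyComb h b)
      (∑ k, (∑ i, eval u (pderiv i (h k)) • coord i : (Fin N → ℝ) →L[ℝ] ℝ).smulRight (b k)) u :=
  HasFDerivAt.fun_sum fun k _ => (hasFDerivAt_eval (h k) u).smul_const (b k)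

theorem fderiv_polyComb {κ : Type*} [Fintype κ] (h : κ → MvPolynomial (Fin N) ℝ)
    (b : κ → DCov (Fin N → ℝ) p q) (u x : Fin N → ℝ) :
    fderiv ℝ (polyComb h b) u x = ∑ i, x i • polyComb (fun k => pderiv i (h k)) b u := by
  rw [(hasFDerivAt_polyComb h b u).fderiv]
  simp only [sum_apply, ContinuousLinearMap.smulRight_apply, smul_apply, polyComb, Finset.sum_smul,
    Finset.smul_sum, smul_smul]
  rw [Finset.sum_comm]
  refine Finset.sum_congr rfl fun i _ => Finset.sum_congr rfl fun k _ => ?_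
  congr 1
  rw [smul_eq_mul, mul_comm]
  rfl

end Polynomials

/-! ### Exterior derivatives of double forms with polynomial coefficients -/

section Derivatives

open MvPolynomial

variable {n N p q r : ℕ} {κ : Type*} [Fintype κ]

theorem dL_polyComb (h : κ → MvPolynomial (Fin (n + 1)) ℝ)
    (b : κ → DCov (Fin (n + 1) → ℝ) p q) (u : Fin (n + 1) → ℝ) :
    dL (polyComb h b) u
      = ∑ i, mapL q (wedge (coord i) p) (polyComb (fun k => pderiv i (h k)) b u) := by
  ext X Y
  have h1 : dL (polyComb h b) u X = ∑ a : Fin (p + 1), (-1 : ℤ) ^ (a : ℕ) •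
      fderiv ℝ (polyComb h b) u (X a) (a.removeNth X) :=
    ContinuousAlternatingMap.alternatizeUncurryFin_apply _ _
  rw [h1]
  simp only [fderiv_polyComb, ContinuousAlternatingMap.sum_apply,
    ContinuousAlternatingMap.smul_apply, mapL_wedge_apply]
  rw [Finset.sum_comm]
  refine Finset.sum_congr rfl fun a _ => ?_
  rw [Finset.smul_sum]
  refine Finset.sum_congr rfl fun i _ => ?_
  rw [zsmul_eq_mul]
  push_cast
  rfl

theorem transpose_polyComb (h : κ → MvPolynomial (Fin N) ℝ) (b : κ → DCov (Fin N → ℝ) p q)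
    (u : Fin N → ℝ) : transpose (polyComb h b u) = polyComb h (fun k => transpose (b k)) u :=
  map_polyComb transpose h b u

theorem dR_polyComb (h : κ → MvPolynomial (Fin (n + 1)) ℝ)
    (b : κ → DCov (Fin (n + 1) → ℝ) p q) (u : Fin (n + 1) → ℝ) :
    dR (polyComb h b) u
      = ∑ i, mapR p (wedge (coord i) q) (polyComb (fun k => pderiv i (h k)) b u) := by
  have h1 : dR (polyComb h b) u = transpose (dL (polyComb h fun k => transpose (b k)) u) := by
    unfold dR dL
    congr 2
    funext y
    exact transpose_polyComb h b y
  rw [h1, dL_polyComb, map_sum]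
  refine Finset.sum_congr rfl fun i _ => ?_
  rw [mapL_apply, transpose_transpose, ← transpose_polyComb, transpose_transpose]

theorem dL_dR_polyComb (h : κ → MvPolynomial (Fin (n + 1)) ℝ)
    (b : κ → DCov (Fin (n + 1) → ℝ) p q) (u : Fin (n + 1) → ℝ) :
    dL (dR (polyComb h b)) u = ∑ i, ∑ j, mapL (q + 1) (wedge (coord i) p)
      (mapR p (wedge (coord j) q) (polyComb (fun k => pderiv i (pderiv j (h k))) b u)) := by
  have h1 : dR (polyComb h b) = polyComb (fun k : Fin (n + 1) × κ => pderiv k.1 (h k.2))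
      (fun k => mapR p (wedge (coord k.1) q) (b k.2)) := by
    funext u
    rw [dR_polyComb, polyComb, Fintype.sum_prod_type]
    exact Finset.sum_congr rfl fun i _ => map_polyComb _ _ _ _
  rw [h1, dL_polyComb]
  refine Finset.sum_congr rfl fun i _ => ?_
  rw [polyComb, Fintype.sum_prod_type, map_sum]
  refine Finset.sum_congr rfl fun j _ => ?_
  rw [map_polyComb]

theorem mapL_wedge_mapR_wedge_tensorMap_hodge {j k : ℕ} (hp : p + 1 + j = N) (hq : q + 1 + k = N)
    (i i' : Fin N) (ψ : DCov (Fin N → ℝ) (p + 1) (q + 1)) :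
    mapL (k + 1) (wedge (coord i) j) (mapR j (wedge (coord i') k)
        (tensorMap (hodge N (p + 1) j) (hodge N (q + 1) k) ψ))
      = (-1 : ℝ) ^ (p + q) • tensorMap (hodge N p (j + 1)) (hodge N q (k + 1))
        (mapL q (contract p (bv i)) (mapR (p + 1) (contract q (bv i')) ψ)) := by
  have hR : mapR (p + 1) (wedge (coord i') k) (mapR (p + 1) (hodge N (q + 1) k) ψ)
      = (-1 : ℝ) ^ q • mapR (p + 1) (hodge N q (k + 1))
        (mapR (p + 1) (contract q (bv i')) ψ) := by
    apply ContinuousAlternatingMap.ext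
    intro X
    exact wedge_hodge hq i' (ψ X)
  have hL : ∀ χ : DCov (Fin N → ℝ) (p + 1) (k + 1),
      mapL (k + 1) (wedge (coord i) j) (mapL (k + 1) (hodge N (p + 1) j) χ)
      = (-1 : ℝ) ^ p • mapL (k + 1) (hodge N p (j + 1))
        (mapL (k + 1) (contract p (bv i)) χ) := by
    intro χ
    ext X Y
    exact congrArg (fun γ : Alt (Fin N → ℝ) ℝ (j + 1) => γ X)
      (wedge_hodge hp i (transpose χ Y))
  rw [tensorMap_eq, tensorMap_eq, ← mapL_mapR_comm, hL, hR]
  rw [map_smul, map_smul, mapL_mapR_comm (contract p (bv i)), smul_smul, pow_add]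

end Derivatives

/-! ### Pullback under the squaring map -/

section Squares

open MvPolynomial

variable {n p q r : ℕ}

theorem fderiv_sqMap (u x : Fin (n + 1) → ℝ) :
    fderiv ℝ (sqMap n) u x = fun i => 2 * u i * x i := by
  have h : HasFDerivAt (sqMap n)
      (ContinuousLinearMap.pi fun i => (2 * u i) • coord i) u := by
    rw [hasFDerivAt_pi]
    intro i
    have := (coord i : (Fin (n + 1) → ℝ) →L[ℝ] ℝ).hasFDerivAt (x := u) |>.pow 2
    simpa [sqMap] using this
  rw [h.fderiv]
  rfl

theorem pullSq_ev (φ : EForm n p q) (u : Fin (n + 1) → ℝ) (f : Fin p → Fin (n + 1))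
    (g : Fin q → Fin (n + 1)) :
    pullSq φ u (ev f) (ev g) = (∏ a, (2 * u (f a))) * (∏ b, (2 * u (g b))) *
      φ (sqMap n u) (ev f) (ev g) := by
  have e : ∀ (k : ℕ) (f : Fin k → Fin (n + 1)),
      (fun a => fderiv ℝ (sqMap n) u (ev f a)) = fun a => (2 * u (f a)) • ev f a := by
    intro k f
    funext a i
    rw [fderiv_sqMap]
    by_cases h : i = f a
    · subst h; simp [ev]
    · simp [ev, h]
  rw [pullSq, pull_apply, e, e, ContinuousAlternatingMap.map_smul_univ,
    ContinuousAlternatingMap.map_smul_univ (φ (sqMap n u)), ContinuousAlternatingMap.smul_apply,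
    smul_eq_mul, smul_eq_mul]
  ring

theorem wedge_smul_left {V : Type*} [NormedAddCommGroup V] [NormedSpace ℝ V] (t : ℝ)
    (l : V →L[ℝ] ℝ) (α : Alt V ℝ q) : wedge (t • l) q α = t • wedge l q α := by
  ext Y
  simp only [wedge_apply, ContinuousAlternatingMap.smul_apply, smul_apply, smul_eq_mul,
    Finset.mul_sum]
  exact Finset.sum_congr rfl fun a _ => by ring

theorem wedge₂_smul_left {V : Type*} [NormedAddCommGroup V] [NormedSpace ℝ V] (t : ℝ)
    (l : V →L[ℝ] ℝ) (φ : DCov V p q) : wedge₂ (t • l) p q φ = (t * t) • wedge₂ l p q φ := by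
  have hR : mapR p (wedge (t • l) q) φ = t • mapR p (wedge l q) φ := by
    apply ContinuousAlternatingMap.ext
    intro X
    exact wedge_smul_left t l (φ X)
  change mapL (q + 1) (wedge (t • l) p) (mapR p (wedge (t • l) q) φ) = _
  rw [hR, map_smul, mul_smul]
  congr 1
  ext X Y
  exact congrArg (fun γ : Alt V ℝ (p + 1) => γ X)
    (wedge_smul_left t l (transpose (mapR p (wedge l q) φ) Y))

/-- `Φ^*σ = ∑ uᵢ²`, whose differential is `2ν`. Hence multiplying `Φ^*φ` by `ν` on both sides is `¼
Φ^*` of multiplying `φ` by `dσ` on both sides. -/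
theorem nu_eq (u : Fin (n + 1) → ℝ) :
    nu u = (1 / 2 : ℝ) • (sigma (n + 1) ∘L fderiv ℝ (sqMap n) u) := by
  ext x
  rw [smul_apply, ContinuousLinearMap.comp_apply, sigma_apply, fderiv_sqMap]
  simp only [nu, sum_apply, smul_apply, smul_eq_mul, Finset.mul_sum, ContinuousLinearMap.proj_apply]
  exact Finset.sum_congr rfl fun i _ => by ring

theorem wedge₂_nu (φ : EForm n p q) (u : Fin (n + 1) → ℝ) :
    wedge₂ (nu u) p q (pullSq φ u)
      = (1 / 4 : ℝ) • pullSq (fun x => wedge₂ (sigma (n + 1)) p q (φ x)) u := by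
  rw [nu_eq, wedge₂_smul_left, pullSq, wedge₂_pull]
  norm_num
  rfl

theorem tensorMap_comp {N p' q' p'' q'' : ℕ}
    (A : Alt (Fin N → ℝ) ℝ p' →L[ℝ] Alt (Fin N → ℝ) ℝ p'')
    (A' : Alt (Fin N → ℝ) ℝ p →L[ℝ] Alt (Fin N → ℝ) ℝ p')
    (B : Alt (Fin N → ℝ) ℝ q' →L[ℝ] Alt (Fin N → ℝ) ℝ q'')
    (B' : Alt (Fin N → ℝ) ℝ q →L[ℝ] Alt (Fin N → ℝ) ℝ q') (φ : DCov (Fin N → ℝ) p q) :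
    tensorMap (A ∘L A') (B ∘L B') φ = tensorMap A B (tensorMap A' B' φ) := by
  have h : tensorMap (A ∘L A') (B ∘L B') φ
      = mapL q'' A (mapL q'' A' (mapR p B (mapR p B' φ))) := rfl
  rw [h, mapL_mapR_comm A' B]
  rfl

theorem ostarSphere_eq (φ : EForm n p q) (u : Fin (n + 1) → ℝ) :
    ostarSphere φ u = tensorMap (hodge (n + 1) (p + 1) (n - p)) (hodge (n + 1) (q + 1) (n - q))
      (wedge₂ (nu u) p q (φ u)) :=
  tensorMap_comp _ _ _ _ _

/-- The exponent of the monomial `∏ₐ x_{f a}`. -/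
def chi {N : ℕ} (f : Fin p → Fin N) : Fin N →₀ ℕ := ∑ a, Finsupp.single (f a) 1

theorem chi_apply {N : ℕ} (f : Fin p → Fin N) (i : Fin N) : chi f i = occ i f := by
  simp only [chi, occ, Finsupp.finsetSum_apply, Finsupp.single_apply]

theorem chi_vecCons {N : ℕ} (i : Fin N) (f : Fin p → Fin N) :
    chi (Matrix.vecCons i f) = Finsupp.single i 1 + chi f := by
  rw [chi, Fin.sum_univ_succ]
  rfl

theorem monomial_chi {N : ℕ} (f : Fin p → Fin N) :
    monomial (chi f) (1 : ℝ) = ∏ a, X (f a) :=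
  monomial_sum_one _ _

/-- The coefficients of `pullSq (homForm r b)`, as polynomials. -/
def sqPoly (r : ℕ) (b : (Fin (n + 1) →₀ ℕ) → DCov (Fin (n + 1) → ℝ) p q)
    (f : Fin p → Fin (n + 1)) (g : Fin q → Fin (n + 1)) : MvPolynomial (Fin (n + 1)) ℝ :=
  ∑ a ∈ expo (n + 1) r,
    monomial (2 • a + chi f + chi g) ((2 : ℝ) ^ (p + q) * b a (ev f) (ev g))

theorem pullSq_homForm_ev (b : (Fin (n + 1) →₀ ℕ) → DCov (Fin (n + 1) → ℝ) p q)
    (u : Fin (n + 1) → ℝ) (f : Fin p → Fin (n + 1)) (g : Fin q → Fin (n + 1)) :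
    pullSq (homForm r b) u (ev f) (ev g) = eval u (sqPoly r b f g) := by
  rw [pullSq_ev, homForm_apply, eval_homPoly, sqPoly, map_sum, Finset.mul_sum]
  refine Finset.sum_congr rfl fun a _ => ?_
  have e : monomial (2 • a + chi f + chi g) ((2 : ℝ) ^ (p + q) * b a (ev f) (ev g))
      = monomial (2 • a) ((2 : ℝ) ^ (p + q) * b a (ev f) (ev g)) * (∏ c, X (f c))
        * (∏ c, X (g c)) := by
    rw [← monomial_chi, ← monomial_chi, monomial_mul, monomial_mul, mul_one, mul_one]
  rw [e, map_mul, map_mul, eval_monomial, map_prod, map_prod, Finsupp.prod_pow]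
  simp only [eval_X, Finset.prod_mul_distrib, Finset.prod_const, Finset.card_univ,
    Fintype.card_fin, sqMap, Finsupp.smul_apply, smul_eq_mul, pow_mul]
  ring

theorem X_mul_pderiv_prod_X {N : ℕ} (i : Fin N) :
    X i * pderiv i (∏ k, X k : MvPolynomial (Fin N) ℝ) = ∏ k, X k := by
  have h := monomial_chi (id : Fin N → Fin N)
  simp only [id] at h
  rw [← h, X_mul_pderiv_monomial]
  have h2 : chi (id : Fin N → Fin N) i = 1 := by
    rw [chi_apply, occ]
    simp
  rw [h2, one_smul]

theorem X_mul_pderiv_sum_monomial {N : ℕ} {ι : Type*} (s : Finset ι) (e : ι → Fin N →₀ ℕ)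
    (t : ι → ℝ) (i : Fin N) :
    X i * pderiv i (∑ a ∈ s, monomial (e a) (t a))
      = ∑ a ∈ s, monomial (e a) ((e a i : ℝ) * t a) := by
  rw [map_sum, Finset.mul_sum]
  refine Finset.sum_congr rfl fun a _ => ?_
  rw [X_mul_pderiv_monomial, smul_monomial, nsmul_eq_mul]

/-- Second derivatives of the quotient of a polynomial by the product of the variables. -/
theorem pderiv_pderiv_quotient {N : ℕ} {ι : Type*} (s : Finset ι) (e : ι → Fin N →₀ ℕ)
    (t : ι → ℝ) (G : MvPolynomial (Fin N) ℝ)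
    (hG : (∏ k, X k) * G = ∑ a ∈ s, monomial (e a) (t a)) (i j : Fin N) :
    X i * X j * ((∏ k, X k) * pderiv i (pderiv j G))
      = ∑ a ∈ s, monomial (e a)
        (((e a i : ℝ) - 1 - if i = j then 1 else 0) * ((e a j : ℝ) - 1) * t a) := by
  set P : MvPolynomial (Fin N) ℝ := ∏ k, X k with hP
  have hPi : ∀ i, X i * pderiv i P = P := fun i => X_mul_pderiv_prod_X i
  -- The Euler operator `Xⱼ∂ⱼ` multiplies a monomial by its exponent of `Xⱼ`. Since `P` has exponent
  -- one, division by `P` lowers the factor by one.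
  have h1 : P * (X j * pderiv j G)
      = ∑ a ∈ s, monomial (e a) (((e a j : ℝ) - 1) * t a) := by
    have h := X_mul_pderiv_sum_monomial s e t j
    rw [← hG, pderiv_mul] at h
    simp only [sub_mul, one_mul, map_sub, Finset.sum_sub_distrib]
    rw [← h, ← hG]
    linear_combination (-G) * hPi j
  have h2 : P * (X i * pderiv i (X j * pderiv j G))
      = ∑ a ∈ s, monomial (e a) (((e a i : ℝ) - 1) * (((e a j : ℝ) - 1) * t a)) := by
    have h := X_mul_pderiv_sum_monomial s e (fun a => ((e a j : ℝ) - 1) * t a) i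
    rw [← h1, pderiv_mul] at h
    have hs : ∑ a ∈ s, monomial (e a) (((e a i : ℝ) - 1) * (((e a j : ℝ) - 1) * t a))
        = ∑ a ∈ s, monomial (e a) ((e a i : ℝ) * (((e a j : ℝ) - 1) * t a))
          - ∑ a ∈ s, monomial (e a) (((e a j : ℝ) - 1) * t a) := by
      rw [← Finset.sum_sub_distrib]
      refine Finset.sum_congr rfl fun a _ => ?_
      rw [← map_sub]
      congr 1
      ring
    rw [hs, ← h, ← h1]
    linear_combination (-(X j * pderiv j G)) * hPi i
  have h3 : ∑ a ∈ s, monomial (e a)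
        (((e a i : ℝ) - 1 - if i = j then 1 else 0) * ((e a j : ℝ) - 1) * t a)
      = P * (X i * pderiv i (X j * pderiv j G))
        - (if i = j then 1 else 0) * (P * (X j * pderiv j G)) := by
    rw [h2, h1, Finset.mul_sum, ← Finset.sum_sub_distrib]
    refine Finset.sum_congr rfl fun a _ => ?_
    split_ifs
    · rw [one_mul, ← map_sub]
      congr 1
      ring
    · rw [zero_mul, sub_zero, sub_zero, mul_assoc]
  -- The extra `-1` for `i = j` comes from `∂ᵢ` acting on the factor `Xⱼ` in `Xⱼ∂ⱼG`.
  rw [h3, pderiv_mul, pderiv_X]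
  by_cases hij : i = j
  · subst hij
    simp only [Pi.single_eq_same, if_true]
    ring
  · simp only [Pi.single_eq_of_ne' hij, if_neg hij]
    ring

theorem alt_vecCons_ev_eq_zero {N : ℕ} {F : Type*} [NormedAddCommGroup F] [NormedSpace ℝ F]
    (α : Alt (Fin N → ℝ) F (p + 1)) (i : Fin N) (f : Fin p → Fin N) (h : occ i f ≠ 0) :
    α (ev (Matrix.vecCons i f)) = 0 := by
  obtain ⟨a, ha⟩ := exists_of_occ_pos h
  exact α.map_eq_zero_of_eq _ (i := 0) (j := a.succ) (by simp [ev, ha]) (Fin.succ_ne_zero a).symm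

end Squares

/-! ### The extension -/

section Core

open MvPolynomial

variable {n p q r : ℕ}

/-- The differentiated exponents equal the weights of `Aᴸ` and `Aᴿ` wherever the component of `b a`
is nonzero. This is why the codifferential of the quotient is again the pullback of a polynomial
form. -/
theorem prod_X_mul_pderiv_pderiv (b : (Fin (n + 1) →₀ ℕ) → DCov (Fin (n + 1) → ℝ) (p + 1) (q + 1))
    (f : Fin p → Fin (n + 1)) (g : Fin q → Fin (n + 1)) (i j : Fin (n + 1))
    (G : MvPolynomial (Fin (n + 1)) ℝ)
    (hG : (∏ k, X k) * G
      = C (1 / 4) * sqPoly r b (Matrix.vecCons i f) (Matrix.vecCons j g)) :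
    (∏ k, X k) * pderiv i (pderiv j G) = ∑ a ∈ expo (n + 1) r,
      monomial (2 • a + chi f + chi g) ((2 : ℝ) ^ (p + q) *
        ((2 * a i + occ i g) * (2 * a j + occ j (Matrix.vecCons i f))
          * b a (ev (Matrix.vecCons i f)) (ev (Matrix.vecCons j g)))) := by
  have h1 : (∏ k, X k) * G = ∑ a ∈ expo (n + 1) r,
      monomial (2 • a + chi (Matrix.vecCons i f) + chi (Matrix.vecCons j g))
        ((2 : ℝ) ^ (p + q) * b a (ev (Matrix.vecCons i f)) (ev (Matrix.vecCons j g))) := by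
    -- Pullback of `p + q + 2` coordinate differentials gives `2^(p+q+2)`, and the factor `1/4` from
    -- `ν` reduces this to `2^(p+q)`.
    rw [hG, sqPoly, Finset.mul_sum]
    refine Finset.sum_congr rfl fun a _ => ?_
    rw [C_mul_monomial]
    congr 1
    ring
  have h2 := pderiv_pderiv_quotient _ _ _ G h1 i j
  have hX : (X i * X j : MvPolynomial (Fin (n + 1)) ℝ) ≠ 0 := mul_ne_zero (X_ne_zero i) (X_ne_zero j)
  refine mul_left_cancel₀ hX (h2.trans ?_)
  rw [Finset.mul_sum]
  refine Finset.sum_congr rfl fun a _ => ?_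
  have h3 : (X i * X j : MvPolynomial (Fin (n + 1)) ℝ)
      = monomial (Finsupp.single i 1 + Finsupp.single j 1) 1 := by
    rw [X, X, monomial_mul, one_mul]
  rw [h3, monomial_mul, one_mul, chi_vecCons, chi_vecCons]
  have h4 : 2 • a + (Finsupp.single i 1 + chi f) + (Finsupp.single j 1 + chi g)
      = Finsupp.single i 1 + Finsupp.single j 1 + (2 • a + chi f + chi g) := by abel
  rw [h4]
  congr 1
  simp only [Finsupp.add_apply, Finsupp.smul_apply, Finsupp.single_apply, chi_apply, smul_eq_mul,
    occ_vecCons]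
  -- The exponents also contain `occ i f` and `occ j g`. If either is nonzero, the component has a
  -- repeated index and vanishes; otherwise the exponents less their corrections are the stated
  -- weights.
  by_cases hf : occ i f = 0
  · by_cases hg : occ j g = 0
    · rw [hf, hg]
      by_cases hij : i = j
      · subst hij
        simp only [hf, hg, if_true]
        push_cast
        ring
      · simp only [if_neg hij, if_neg (Ne.symm hij), if_true]
        push_cast
        ring
    · rw [alt_vecCons_ev_eq_zero _ j g hg]
      ring
  · rw [alt_vecCons_ev_eq_zero (b a) i f hf]
    simp

/-- Division of a pulled back form by the product of the coordinates, and the double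
codifferential of the quotient. -/
theorem exists_quotient (b : (Fin (n + 1) →₀ ℕ) → DCov (Fin (n + 1) → ℝ) (p + 1) (q + 1))
    (hb : ∀ (i : Fin (n + 1)) (u : Fin (n + 1) → ℝ), u i = 0 → pullSq (homForm r b) u = 0) :
    ∃ (k : ℕ) (h : Fin k → MvPolynomial (Fin (n + 1)) ℝ)
      (d : Fin k → DCov (Fin (n + 1) → ℝ) (p + 1) (q + 1)),
      (∀ u, (∏ i, u i) • polyComb h d u = (1 / 4 : ℝ) • pullSq (homForm r b) u) ∧
      ∀ u, (∏ i, u i) • (∑ i, ∑ j, mapL q (contract p (bv i)) (mapR (p + 1) (contract q (bv j))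
        (polyComb (fun k => pderiv i (pderiv j (h k))) d u)))
        = pullSq (homForm r fun a => dcontract (fun i => 2 * (a i : ℝ)) p q (b a)) u := by
  obtain ⟨k, h₀, d, hd, h0⟩ := exists_polyComb
    (fun u => (1 / 4 : ℝ) • pullSq (homForm r b) u) fun f g => ⟨C (1 / 4) * sqPoly r b f g,
      fun u => by
        rw [map_mul, eval_C, ← pullSq_homForm_ev]
        rfl⟩
  -- The coefficients are taken with respect to a basis, so they all vanish wherever the form does,
  -- in particular on each hyperplane `uᵢ = 0`.
  have hdvd : ∀ j, ∏ i, X i ∣ h₀ j := fun j => prod_X_dvd _ fun i u hu =>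
    h0 u j (by simp only [hb i u hu, smul_zero])
  choose h hh using hdvd
  have h1 : ∀ u, (∏ i, u i) • polyComb h d u = (1 / 4 : ℝ) • pullSq (homForm r b) u := by
    intro u
    rw [congrFun hd u, polyComb, polyComb, Finset.smul_sum]
    refine Finset.sum_congr rfl fun j _ => ?_
    rw [hh j, map_mul, map_prod, mul_smul]
    simp only [eval_X]
  refine ⟨k, h, d, h1, fun u => ?_⟩
  refine dcov_ext_ev fun f g => ?_
  rw [pullSq_homForm_ev]
  have h2 : ∀ i j, (∏ i, u i) * polyComb (fun k => pderiv i (pderiv j (h k))) d u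
        (ev (Matrix.vecCons i f)) (ev (Matrix.vecCons j g))
      = eval u (∑ a ∈ expo (n + 1) r,
      monomial (2 • a + chi f + chi g) ((2 : ℝ) ^ (p + q) *
        ((2 * a i + occ i g) * (2 * a j + occ j (Matrix.vecCons i f))
          * b a (ev (Matrix.vecCons i f)) (ev (Matrix.vecCons j g))))) := by
    intro i j
    let G := ∑ k, C (d k (ev (Matrix.vecCons i f)) (ev (Matrix.vecCons j g))) * h k
    have hG : (∏ k, X k) * G
        = C (1 / 4) * sqPoly r b (Matrix.vecCons i f) (Matrix.vecCons j g) := by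
      refine MvPolynomial.funext fun v => ?_
      rw [map_mul, map_mul, ← polyComb_apply, ← pullSq_homForm_ev, map_prod, eval_C]
      simp only [eval_X]
      exact congrArg (fun γ : DCov (Fin (n + 1) → ℝ) (p + 1) (q + 1) =>
        γ (ev (Matrix.vecCons i f)) (ev (Matrix.vecCons j g))) (h1 v)
    rw [← prod_X_mul_pderiv_pderiv b f g i j G hG, polyComb_apply, map_mul, map_prod]
    simp only [eval_X, G, map_sum, pderiv_C_mul]
  have h3 : ∀ (i j : Fin (n + 1)) (ψ : DCov (Fin (n + 1) → ℝ) (p + 1) (q + 1)),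
      mapL q (contract p (bv i)) (mapR (p + 1) (contract q (bv j)) ψ) (ev f) (ev g)
      = ψ (ev (Matrix.vecCons i f)) (ev (Matrix.vecCons j g)) := by
    intro i j ψ
    rw [← vecCons_ev, ← vecCons_ev]
    rfl
  simp only [ContinuousAlternatingMap.smul_apply, ContinuousAlternatingMap.sum_apply, h3,
    smul_eq_mul, Finset.mul_sum, h2]
  simp only [sqPoly, dcontract_ev, Finset.mul_sum, map_sum]
  conv_rhs => rw [Finset.sum_comm]
  refine Finset.sum_congr rfl fun i _ => ?_
  conv_rhs => rw [Finset.sum_comm]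

end Core

/-! ### Homogeneous extensions, traces, and uniqueness of the inverses. -/

section Extension

open MvPolynomial

variable {n N p q r : ℕ} {m : ℤ}

theorem map_homForm {p' q' : ℕ} (T : DCov (Fin N → ℝ) p q →ₗ[ℝ] DCov (Fin N → ℝ) p' q')
    (c : (Fin N →₀ ℕ) → DCov (Fin N → ℝ) p q) (x : Fin N → ℝ) :
    T (homForm r c x) = homForm r (fun a => T (c a)) x := by
  simp [homForm]

theorem homForm_congr {c c' : (Fin N →₀ ℕ) → DCov (Fin N → ℝ) p q}
    (h : ∀ a ∈ expo N r, c a = c' a) : homForm r c = homForm r c' := by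
  funext x
  exact Finset.sum_congr rfl fun a ha => by rw [h a ha]

theorem homForm_smul (c : (Fin N →₀ ℕ) → DCov (Fin N → ℝ) p q) (t : ℝ) (x : Fin N → ℝ) :
    homForm r c (t • x) = t ^ r • homForm r c x := by
  refine dcov_ext_ev fun f g => ?_
  rw [homForm_apply, eval_smul_of_isHomogeneous (isHomogeneous_homPoly _), ← homForm_apply]
  rfl

theorem coeff_mem_summand {c : (Fin (n + 1) →₀ ℕ) → DCov (Fin (n + 1) → ℝ) p q}
    (h : ∀ x ∈ stdSimplex ℝ (Fin (n + 1)), homForm r c x ∈ summand _ p q m)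
    {a : Fin (n + 1) →₀ ℕ} (ha : a ∈ expo (n + 1) r) : c a ∈ summand _ p q m := by
  by_cases hm : 0 ≤ m
  · rw [mem_summand_iff hm]
    refine homForm_unique (r := r) (fun a => sStarS _ p q (c a))
      (fun a => ((m : ℝ) * (m + p - q + 1)) • c a) (fun x hx => ?_) ha
    have h1 := (mem_summand_iff hm _).mp (h x hx)
    rw [← map_homForm, h1]
    exact map_homForm (((m : ℝ) * (m + p - q + 1)) • LinearMap.id) c x
  · rw [summand, if_neg hm] at h ⊢
    rw [Submodule.mem_bot]
    refine homForm_unique (r := r) c (fun _ => 0) (fun x hx => ?_) ha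
    rw [(Submodule.mem_bot ℝ).mp (h x hx)]
    simp [homForm]

theorem homForm_mem_homForm (c : (Fin (n + 1) →₀ ℕ) → DCov (Fin (n + 1) → ℝ) p q)
    (h : ∀ a ∈ expo (n + 1) r, c a ∈ summand _ p q m) : homForm r c ∈ HomForm n p q r m :=
  ⟨fun X Y => ⟨_, isHomogeneous_homPoly _, fun x => homForm_apply c x X Y⟩,
    fun _ => Submodule.sum_mem _ fun a ha => Submodule.smul_mem _ _ (h a ha)⟩

theorem mem_polyForm_of_homForm {φ : EForm n p q} (h : φ ∈ HomForm n p q r m) :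
    φ ∈ PolyForm n p q :=
  fun X Y => (h.1 X Y).imp fun _ hP => hP.2

/-- The polynomial of degree `r` that is homogeneous and agrees with `f` on the simplex. -/
theorem exists_homogenization (f : MvPolynomial (Fin N) ℝ) (hf : f.totalDegree ≤ r) :
    ∃ P : MvPolynomial (Fin N) ℝ, P.IsHomogeneous r ∧
      ∀ x ∈ stdSimplex ℝ (Fin N), eval x P = eval x f := by
  -- Each homogeneous component is raised to degree `r` by a power of `∑ Xᵢ`, which equals `1` on
  -- the simplex.
  refine ⟨∑ k ∈ Finset.range (r + 1), homogeneousComponent k f * (∑ i, X i) ^ (r - k),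
    IsHomogeneous.sum _ _ _ fun k hk => ?_, fun x hx => ?_⟩
  · have h1 : (∑ i, X i : MvPolynomial (Fin N) ℝ).IsHomogeneous 1 :=
      IsHomogeneous.sum _ _ _ fun i _ => isHomogeneous_X _ i
    have h2 := (homogeneousComponent_isHomogeneous k f).mul (h1.pow (r - k))
    have e : k + 1 * (r - k) = r := by
      rw [Finset.mem_range] at hk
      omega
    rwa [e] at h2
  · have h1 : ∑ k ∈ Finset.range (r + 1), homogeneousComponent k f = f := by
      conv_rhs => rw [← sum_homogeneousComponent f]
      refine (Finset.sum_subset (by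
        intro k hk
        rw [Finset.mem_range] at hk ⊢
        omega) fun k _ hk => homogeneousComponent_eq_zero _ _ (by
          rw [Finset.mem_range] at hk
          omega)).symm
    conv_rhs => rw [← h1]
    rw [map_sum, map_sum]
    refine Finset.sum_congr rfl fun k _ => ?_
    rw [map_mul, map_pow, map_sum]
    simp only [eval_X]
    rw [hx.2, one_pow, mul_one]

theorem mem_tangent (v : Fin (n + 1) → ℝ) : v ∈ tangent n ↔ ∑ i, v i = 0 := Iff.rfl

theorem sigma_single : sigma (n + 1) (Pi.single 0 1) = 1 := by
  rw [sigma_apply]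
  simp

/-- The projection of `ℝ^{n+1}` onto the tangent space of the simplex along a basis vector. -/
def tangentProj (n : ℕ) : (Fin (n + 1) → ℝ) →L[ℝ] tangent n :=
  (ContinuousLinearMap.id ℝ _ - (sigma (n + 1)).smulRight (Pi.single 0 1)).codRestrict _ fun v => by
    rw [mem_tangent, ← sigma_apply, sub_apply, map_sub, ContinuousLinearMap.smulRight_apply,
      map_smul, sigma_single]
    simp

theorem tangentProj_coe (v : tangent n) : tangentProj n (v : Fin (n + 1) → ℝ) = v := by
  have h : sigma (n + 1) (v : Fin (n + 1) → ℝ) = 0 := by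
    rw [sigma_apply]
    exact (mem_tangent _).mp v.2
  apply Subtype.ext
  change (v : Fin (n + 1) → ℝ) - sigma (n + 1) (v : Fin (n + 1) → ℝ) • _ = _
  rw [h, zero_smul, sub_zero]

/-- Every polynomial double form on the simplex has a homogeneous extension. -/
theorem exists_extension {φbar : TForm n p q} (h : φbar ∈ SimplexForm n p q r m) :
    ∃ c : (Fin (n + 1) →₀ ℕ) → DCov (Fin (n + 1) → ℝ) p q,
      (∀ a ∈ expo (n + 1) r, c a ∈ summand _ p q m) ∧ IsExtension (homForm r c) φbar := by
  -- The values are carried to `ℝ^{n+1}` by pullback along a constant projection onto the tangent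
  -- space. This keeps them polynomial and, by naturality of `s*s`, inside `Λ_m`.
  obtain ⟨c, hc⟩ := exists_homForm (r := r)
    (fun x : stdSimplex ℝ (Fin (n + 1)) => (x : Fin (n + 1) → ℝ))
    (fun x => pull (tangentProj n) (φbar x)) fun f g => by
      obtain ⟨P, hP, hx⟩ := h.1 (fun a => tangentProj n (ev f a)) (fun b => tangentProj n (ev g b))
      obtain ⟨Q, hQ, hQx⟩ := exists_homogenization P hP
      exact ⟨Q, hQ, fun x => by rw [hQx x x.2, ← hx x, pull_apply]⟩
  refine ⟨c, fun a ha => coeff_mem_summand (fun x hx => ?_) ha, funext fun x => ?_⟩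
  · have h1 : pull (tangentProj n) (φbar ⟨x, hx⟩) = homForm r c x := hc ⟨x, hx⟩
    rw [← h1]
    exact pull_mem_summand _ (h.2 _)
  · ext X Y
    rw [restrict, ← hc x, pull_apply, pull_apply]
    simp only [Submodule.subtypeL_apply, tangentProj_coe]

theorem IsExtension.apply_eq {φ : EForm n p q} {φbar : TForm n p q} (h : IsExtension φ φbar)
    {x : Fin (n + 1) → ℝ} (hx : x ∈ stdSimplex ℝ (Fin (n + 1))) (X : Fin p → Fin (n + 1) → ℝ)
    (Y : Fin q → Fin (n + 1) → ℝ) (hX : ∀ a, sigma (n + 1) (X a) = 0)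
    (hY : ∀ b, sigma (n + 1) (Y b) = 0) :
    φ x X Y = φbar ⟨x, hx⟩ (fun a => ⟨X a, by rw [mem_tangent, ← sigma_apply]; exact hX a⟩)
      (fun b => ⟨Y b, by rw [mem_tangent, ← sigma_apply]; exact hY b⟩) := by
  rw [← h]
  rfl

theorem IsExtension.wedge₂_eq {φ ψ : EForm n p q} {φbar : TForm n p q} (h : IsExtension φ φbar)
    (h' : IsExtension ψ φbar) {x : Fin (n + 1) → ℝ} (hx : x ∈ stdSimplex ℝ (Fin (n + 1))) :
    wedge₂ (sigma (n + 1)) p q (φ x) = wedge₂ (sigma (n + 1)) p q (ψ x) := by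
  rw [← sub_eq_zero, ← map_sub]
  refine wedge₂_eq_zero_of_ker _ _ sigma_single _ fun X Y hX hY => ?_
  rw [ContinuousAlternatingMap.sub_apply, ContinuousAlternatingMap.sub_apply,
    h.apply_eq hx X Y hX hY, h'.apply_eq hx X Y hX hY, sub_self]

/-- The tangent space of the simplex is `ker dσ`, so being an extension is a condition on `dσ ∧ᴸ dσ
∧ᴿ ψ` along the simplex only. -/
theorem IsExtension.of_wedge₂_eq {φ ψ : EForm n p q} {φbar : TForm n p q} (h : IsExtension φ φbar)
    (h' : ∀ x ∈ stdSimplex ℝ (Fin (n + 1)),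
      wedge₂ (sigma (n + 1)) p q (ψ x) = wedge₂ (sigma (n + 1)) p q (φ x)) :
    IsExtension ψ φbar := by
  funext x
  rw [← h]
  ext X Y
  have h1 := h' x x.2
  rw [← sub_eq_zero, ← map_sub] at h1
  have hs : ∀ v : tangent n, sigma (n + 1) (v : Fin (n + 1) → ℝ) = 0 := fun v => by
    rw [sigma_apply]
    exact (mem_tangent _).mp v.2
  have h2 := eq_zero_of_wedge₂_eq_zero _ _ sigma_single _ h1 (fun a => (X a : Fin (n + 1) → ℝ))
    (fun b => (Y b : Fin (n + 1) → ℝ)) (fun a => hs _) fun b => hs _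
  rw [ContinuousAlternatingMap.sub_apply, ContinuousAlternatingMap.sub_apply, sub_eq_zero] at h2
  exact h2

/-- The pulled back form vanishes on the coordinate hyperplanes after exterior multiplication
by `ν`. -/
theorem wedge₂_nu_eq_zero {φbar : TForm n p q} (ht : SimplexTraceFree φbar)
    {c : (Fin (n + 1) →₀ ℕ) → DCov (Fin (n + 1) → ℝ) p q}
    (hc : IsExtension (homForm r c) φbar) (i : Fin (n + 1)) (u : Fin (n + 1) → ℝ) (hu : u i = 0) :
    wedge₂ (nu u) p q (pullSq (homForm r c) u) = 0 := by
  by_cases h0 : u = 0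
  · have : nu u = (0 : ℝ) • nu u := by
      rw [h0, zero_smul]
      simp [nu]
    rw [this, wedge₂_smul_left, mul_zero, zero_smul]
  have hs : 0 < ∑ j, u j ^ 2 := by
    obtain ⟨j, hj⟩ := Function.ne_iff.mp h0
    exact Finset.sum_pos' (fun _ _ => sq_nonneg _) ⟨j, Finset.mem_univ _, by
      have : u j ≠ 0 := hj
      positivity⟩
  set s := ∑ j, u j ^ 2 with hs'
  have hnu : ∀ x, nu u x = ∑ j, u j * x j := fun x => by simp [nu, sum_apply]
  -- It suffices to test on vectors tangent to the sphere, `u/|u|²` being dual to `ν`. The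
  -- differential of `Φ` maps these into `ker dσ`, and homogeneity rescales `Φ(u)` to a point of the
  -- simplex.
  refine wedge₂_eq_zero_of_ker (nu u) (s⁻¹ • u) ?_ _ fun X Y hX hY => ?_
  · rw [map_smul, hnu, smul_eq_mul]
    have : ∑ j, u j * u j = s := Finset.sum_congr rfl fun j _ => (sq (u j)).symm
    rw [this, inv_mul_cancel₀ hs.ne']
  have hy : s⁻¹ • sqMap n u ∈ stdSimplex ℝ (Fin (n + 1)) := by
    refine ⟨fun j => mul_nonneg (inv_nonneg.mpr hs.le) (sq_nonneg _), ?_⟩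
    simp only [Pi.smul_apply, smul_eq_mul]
    rw [← Finset.mul_sum]
    exact inv_mul_cancel₀ hs.ne'
  have e : sqMap n u = s • (s⁻¹ • sqMap n u) := by
    rw [smul_smul, mul_inv_cancel₀ hs.ne', one_smul]
  have hσ : ∀ x, nu u x = 0 → sigma (n + 1) (fderiv ℝ (sqMap n) u x) = 0 := by
    intro x hx
    rw [sigma_apply, fderiv_sqMap]
    have : ∑ j, 2 * u j * x j = 2 * nu u x := by
      rw [hnu, Finset.mul_sum]
      exact Finset.sum_congr rfl fun j _ => by ring
    rw [this, hx, mul_zero]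
  rw [pullSq, pull_apply, e, homForm_smul, ContinuousAlternatingMap.smul_apply,
    ContinuousAlternatingMap.smul_apply, hc.apply_eq hy _ _ (fun a => hσ _ (hX a))
      fun b => hσ _ (hY b), ht i]
  · exact smul_zero _
  · change s⁻¹ * u i ^ 2 = 0
    rw [hu]
    simp
  -- Since `uᵢ = 0`, the `i`-th component `2uᵢXᵢ` of the image vanishes, so the image is tangent to
  -- the facet.
  · intro a
    simp [fderiv_sqMap, hu]
  · intro b
    simp [fderiv_sqMap, hu]

/-- Where the other coordinates are positive, the restriction of `Φ` to `uᵢ = 0` is locally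
invertible, so the trace vanishes there. A polynomial in those coordinates that vanishes there is
zero. -/
theorem traceFree_of_pullSq {φ : EForm n p q} (hφ : φ ∈ PolyForm n p q)
    (h : ∀ (i : Fin (n + 1)) (u : Fin (n + 1) → ℝ), u i = 0 → pullSq φ u = 0) : TraceFree φ := by
  intro i x hx X Y hX hY
  obtain ⟨P, hP⟩ := hφ X Y
  have h1 : setZero i P = 0 := by
    refine setZero_eq_zero fun y hy hpos => ?_
    rw [← hP]
    let u : Fin (n + 1) → ℝ := fun j => √(y j)
    have hu : sqMap n u = y := by
      funext j
      by_cases hj : j = i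
      · subst hj; simp [sqMap, u, hy]
      · exact Real.sq_sqrt (hpos j hj).le
    -- For `j = i` the quotient is a division by zero, hence `0`; this is harmless because `v i =
    -- 0`.
    have hlift : ∀ v : Fin (n + 1) → ℝ, v i = 0 →
        fderiv ℝ (sqMap n) u (fun j => v j / (2 * u j)) = v := by
      intro v hv
      rw [fderiv_sqMap]
      funext j
      by_cases hj : j = i
      · subst hj; simp [u, hy, hv]
      · have : u j ≠ 0 := (Real.sqrt_pos.mpr (hpos j hj)).ne'
        field_simp
    have h2 := congrArg (fun γ : DCov (Fin (n + 1) → ℝ) p q =>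
      γ (fun a j => X a j / (2 * u j)) (fun b j => Y b j / (2 * u j))) (h i u (by simp [u, hy]))
    simp only [pullSq, pull_apply, hu] at h2
    have hX' : (fun a => fderiv ℝ (sqMap n) u (fun j => X a j / (2 * u j))) = X :=
      funext fun a => hlift _ (hX a)
    have hY' : (fun b => fderiv ℝ (sqMap n) u (fun j => Y b j / (2 * u j))) = Y :=
      funext fun b => hlift _ (hY b)
    rw [hX', hY'] at h2
    exact h2
  have h2 := eval_setZero i P x
  have e := Function.update_eq_self i x
  rw [hx] at e
  rw [h1, map_zero, e] at h2
  rw [hP, ← h2]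

/-- On the positive orthant every point has a square root and the factors `2uⱼ` are invertible, so
`Φ^*` determines the form there; polynomial coefficients extend the equality everywhere. -/
theorem pullSq_injOn : Set.InjOn pullSq (PolyForm n p q) := by
  intro φ hφ ψ hψ h
  funext x
  refine dcov_ext_ev fun f g => ?_
  obtain ⟨P, hP⟩ := hφ (ev f) (ev g)
  obtain ⟨Q, hQ⟩ := hψ (ev f) (ev g)
  have h1 : P - Q = 0 := by
    refine eq_zero_of_eval_pos fun y hy => ?_
    let u : Fin (n + 1) → ℝ := fun j => √(y j)
    have hu0 : ∀ j, 2 * u j ≠ 0 := fun j => mul_ne_zero two_ne_zero (Real.sqrt_pos.mpr (hy j)).ne'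
    have hu : sqMap n u = y := funext fun j => Real.sq_sqrt (hy j).le
    have h2 := congrArg (fun γ : DCov (Fin (n + 1) → ℝ) p q => γ (ev f) (ev g)) (congrFun h u)
    simp only [pullSq_ev, hu] at h2
    rw [map_sub, ← hP, ← hQ, sub_eq_zero]
    exact mul_left_cancel₀ (mul_ne_zero (Finset.prod_ne_zero_iff.mpr fun _ _ => hu0 _)
      (Finset.prod_ne_zero_iff.mpr fun _ _ => hu0 _)) h2
  rw [hP, hQ, sub_eq_zero.mp h1]

theorem mulUN_injOn : Set.InjOn mulUN (PolyForm n p q) := by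
  intro φ hφ ψ hψ h
  funext x
  ext X Y
  obtain ⟨P, hP⟩ := hφ X Y
  obtain ⟨Q, hQ⟩ := hψ X Y
  have h1 : P - Q = 0 := by
    refine eq_zero_of_eval_pos fun y hy => ?_
    have h2 := congrArg (fun γ : DCov (Fin (n + 1) → ℝ) p q => γ X Y) (congrFun h y)
    rw [map_sub, ← hP, ← hQ, sub_eq_zero]
    exact mul_left_cancel₀ (Finset.prod_ne_zero_iff.mpr fun j _ => (hy j).ne') h2
  rw [hP, hQ, sub_eq_zero.mp h1]

theorem ostar_injective {p' q' : ℕ} (hp : p + p' = n + 1) (hq : q + q' = n + 1) :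
    Function.Injective (ostar p' q' : EForm n p q → EForm n p' q') := by
  intro φ ψ h
  funext x
  refine tensorMap_injective _ _ ?_ ?_ (congrFun h x)
  · exact (injective_iff_map_eq_zero _).mpr (hodge_injective p p' hp)
  · exact (injective_iff_map_eq_zero _).mpr (hodge_injective q q' hq)

theorem extConst_ne_zero (hm : 0 ≤ m) (hmq : m ≤ q) (hrm : ¬ (r = 0 ∧ m = (q : ℤ))) :
    extConst p q r m ≠ 0 := by
  have h1 : (0 : ℤ) < 2 * r + p + m + 1 := by omega
  have h2 : (0 : ℤ) < 2 * r + q - m := by omega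
  have h3 : extConst p q r m = ((2 * r + p + m + 1 : ℤ) : ℝ) * ((2 * r + q - m : ℤ) : ℝ) := by
    rw [extConst]
    push_cast
    ring
  rw [h3]
  exact (mul_pos (Int.cast_pos.mpr h1) (Int.cast_pos.mpr h2)).ne'

/-- The coefficients of the extension, in terms of those of `dσ ∧ᴸ dσ ∧ᴿ φ`. -/
def extCoeff (r : ℕ) (m : ℤ) (b : (Fin (n + 1) →₀ ℕ) → DCov (Fin (n + 1) → ℝ) (p + 1) (q + 1))
    (a : Fin (n + 1) →₀ ℕ) : DCov (Fin (n + 1) → ℝ) p q :=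
  (extConst p q r m)⁻¹ • dcontract (fun i => 2 * (a i : ℝ)) p q (b a)

theorem extCoeff_mem_summand (hm : 0 ≤ m)
    {c : (Fin (n + 1) →₀ ℕ) → DCov (Fin (n + 1) → ℝ) p q} {a : Fin (n + 1) →₀ ℕ}
    (hc : c a ∈ summand _ p q m) :
    extCoeff r m (fun a => wedge₂ (sigma (n + 1)) p q (c a)) a ∈ summand _ p q m := by
  refine Submodule.smul_mem _ _ ?_
  rw [mem_summand_iff hm] at hc ⊢
  rw [sStarS_dcontract, hc, map_smul, map_smul]

/-- For an exponent of degree `r` the weights `2aᵢ` add up to `2r`, the same for all monomials. A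
single constant `C` therefore normalises all coefficients at once. -/
theorem wedge₂_extCoeff (hm : 0 ≤ m) (hC : extConst p q r m ≠ 0)
    {c : (Fin (n + 1) →₀ ℕ) → DCov (Fin (n + 1) → ℝ) p q} {a : Fin (n + 1) →₀ ℕ}
    (ha : a ∈ expo (n + 1) r) (hc : c a ∈ summand _ p q m) :
    wedge₂ (sigma (n + 1)) p q (extCoeff r m (fun a => wedge₂ (sigma (n + 1)) p q (c a)) a)
      = wedge₂ (sigma (n + 1)) p q (c a) := by
  have h1 : ∑ i, 2 * (a i : ℝ) = 2 * r := by
    rw [← Finset.mul_sum, ← (mem_expo a).mp ha]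
    push_cast
    rfl
  rw [extCoeff, map_smul, wedge₂_dcontract _ _ _ ((mem_summand_iff hm _).mp hc), h1, smul_smul]
  -- The difference of the degree factor and the eigenvalue of `s*s` factors into the two terms of
  -- `C`.
  have h2 : (2 * (r : ℝ) + q) * (2 * r + p + 1) - (m : ℝ) * (m + p - q + 1) = extConst p q r m := by
    rw [extConst]
    ring
  rw [h2, inv_mul_cancel₀ hC, one_smul]

end Extension

/-! ### The closed formula and its independence of the extension. -/

section Formula

open MvPolynomial

variable {n p q r : ℕ} {m : ℤ}

theorem exists_ne_zero_coeff {φbar : TForm n p q}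
    {c : (Fin (n + 1) →₀ ℕ) → DCov (Fin (n + 1) → ℝ) p q} (hc : IsExtension (homForm r c) φbar)
    (hne : φbar ≠ 0) : ∃ a ∈ expo (n + 1) r, wedge₂ (sigma (n + 1)) p q (c a) ≠ 0 := by
  by_contra! h
  apply hne
  have h1 : IsExtension (fun _ => 0 : EForm n p q) φbar := by
    refine hc.of_wedge₂_eq fun x _ => ?_
    rw [map_zero, map_homForm, homForm_congr (c' := fun _ => 0) h]
    simp [homForm]
  rw [← h1]
  rfl

theorem homForm_const_smul {N : ℕ} (t : ℝ) (c : (Fin N →₀ ℕ) → DCov (Fin N → ℝ) p q)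
    (x : Fin N → ℝ) : homForm r (fun a => t • c a) x = t • homForm r c x := by
  simp only [homForm, Finset.smul_sum]
  exact Finset.sum_congr rfl fun a _ => smul_comm _ _ _

theorem pullSq_extCoeff (b : (Fin (n + 1) →₀ ℕ) → DCov (Fin (n + 1) → ℝ) (p + 1) (q + 1))
    (u : Fin (n + 1) → ℝ) :
    pullSq (homForm r (extCoeff r m b)) u = (extConst p q r m)⁻¹ •
      pullSq (homForm r fun a => dcontract (fun i => 2 * (a i : ℝ)) p q (b a)) u := by
  have h : homForm r (extCoeff r m b) (sqMap n u) = (extConst p q r m)⁻¹ •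
      homForm r (fun a => dcontract (fun i => 2 * (a i : ℝ)) p q (b a)) (sqMap n u) :=
    homForm_const_smul _ _ _
  rw [pullSq, h]
  rfl

/-- The extension formula, for a form `φ` whose exterior product with `dσ` on both sides has the
coefficients `b`. -/
theorem isExtensionFormula (hp : p ≤ n) (hq : q ≤ n) {φ : EForm n p q}
    (b : (Fin (n + 1) →₀ ℕ) → DCov (Fin (n + 1) → ℝ) (p + 1) (q + 1))
    (hb : ∀ (i : Fin (n + 1)) (u : Fin (n + 1) → ℝ), u i = 0 → pullSq (homForm r b) u = 0)
    (hφ : (fun x => wedge₂ (sigma (n + 1)) p q (φ x)) = homForm r b)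
    (hφ' : homForm r (extCoeff r m b) ∈ PolyForm n p q) :
    IsExtensionFormula r m φ (homForm r (extCoeff r m b)) := by
  obtain ⟨k, h, d, h1, h2⟩ := exists_quotient b hb
  have hp' : p + 1 + (n - p) = n + 1 := by omega
  have hq' : q + 1 + (n - q) = n + 1 := by omega
  let T : DCov (Fin (n + 1) → ℝ) (p + 1) (q + 1) →ₗ[ℝ] DCov (Fin (n + 1) → ℝ) (n - p) (n - q) :=
    mapL (n - q) (hodge (n + 1) (p + 1) (n - p)) ∘ₗ
      mapR (p + 1) (hodge (n + 1) (q + 1) (n - q))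
  let δ : EForm n p q := fun u => ∑ i, ∑ j, mapL q (contract p (bv i))
    (mapR (p + 1) (contract q (bv j)) (polyComb (fun k => pderiv i (pderiv j (h k))) d u))
  have hT : ∀ (h : Fin k → MvPolynomial (Fin (n + 1)) ℝ) u,
      polyComb h (fun k => T (d k)) u = T (polyComb h d u) := fun h u => (map_polyComb T h d u).symm
  have hη : ∀ u, mulUN (polyComb h fun k => T (d k)) u = ostarSphere (pullSq φ) u := by
    intro u
    rw [mulUN, hT, ← map_smul, h1, ostarSphere_eq, wedge₂_nu, hφ]
    rfl
  -- Commuting both exterior derivatives past the Hodge stars gives the double divergence `δ` and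
  -- the sign `(-1)^(p+q)`, which the sign in the formula cancels.
  have hχ : ostar (n - p + 1) (n - q + 1) ((-1 : ℝ) ^ (p + q) • δ)
      = dL (dR (polyComb h fun k => T (d k))) := by
    funext u
    rw [dL_dR_polyComb]
    change mapL _ _ (mapR _ _ ((-1 : ℝ) ^ (p + q) • δ u)) = _
    simp only [δ, map_smul, map_sum, Finset.smul_sum]
    refine Finset.sum_congr rfl fun i _ => Finset.sum_congr rfl fun j _ => ?_
    rw [hT]
    exact (mapL_wedge_mapR_wedge_tensorMap_hodge hp' hq' i j _).symm
  have hψ : pullSq (homForm r (extCoeff r m b))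
      = ((-1 : ℝ) ^ (p + q) * (extConst p q r m)⁻¹) • mulUN ((-1 : ℝ) ^ (p + q) • δ) := by
    funext u
    rw [pullSq_extCoeff, ← h2]
    change _ = ((-1 : ℝ) ^ (p + q) * (extConst p q r m)⁻¹) •
      (∏ i, u i) • (-1 : ℝ) ^ (p + q) • δ u
    have hs : (-1 : ℝ) ^ (p + q) * (-1 : ℝ) ^ (p + q) = 1 := by
      rw [← mul_pow]
      norm_num
    rw [smul_smul, smul_smul, smul_smul]
    congr 1
    linear_combination (-(extConst p q r m)⁻¹ * ∏ i, u i) * hs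
  exact ⟨polyComb h fun k => T (d k), (-1 : ℝ) ^ (p + q) • δ,
    ⟨polyComb_mem_polyForm _ _, funext hη, fun η' hη' he =>
      mulUN_injOn hη' (polyComb_mem_polyForm _ _) (he.trans (funext hη).symm)⟩,
    ⟨trivial, hχ, fun χ' _ he => ostar_injective (by omega) (by omega) (he.trans hχ.symm)⟩,
    ⟨hφ', hψ, fun ψ' hψ' he => pullSq_injOn hψ' hφ' (he.trans hψ.symm)⟩⟩

end Formula

end DoubleForm

end

theorem mainTheorem1 (n p q r : ℕ) (m : ℤ) (φbar : DoubleForm.TForm n p q)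
    (hφbar : φbar ∈ DoubleForm.SimplexFormTraceFree n p q r m) (hne : φbar ≠ 0)
    (hrm : ¬ (r = 0 ∧ m = (q : ℤ))) :
    DoubleForm.extConst p q r m ≠ 0 ∧
    ∃ φ' : DoubleForm.EForm n p q,
      φ' ∈ DoubleForm.HomFormTraceFree n p q r m ∧
      DoubleForm.IsExtension φ' φbar ∧
      ∀ φ : DoubleForm.EForm n p q, φ ∈ DoubleForm.HomForm n p q r m →
        DoubleForm.IsExtension φ φbar → DoubleForm.IsExtensionFormula r m φ φ' := by
  obtain ⟨hform, htrace⟩ := hφbar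
  obtain ⟨c, hcm, hc⟩ := DoubleForm.exists_extension hform
  obtain ⟨a, ha, hba⟩ := DoubleForm.exists_ne_zero_coeff hc hne
  have hca : c a ≠ 0 := fun h => hba (by rw [h, map_zero])
  -- A nonzero form has a coefficient whose product with `dσ` on both sides is nonzero. Its
  -- membership in `Λ_m` bounds `m`, and its bidegree `(p+1, q+1)` bounds `p` and `q` by `n`.
  have hmq : 0 ≤ m ∧ m ≤ q := by
    by_contra h
    exact hca (DoubleForm.summand_eq_zero _ (hcm a ha) (by omega))
  have hp : p ≤ n := by
    by_contra h
    exact hba (DoubleForm.alt_eq_zero_of_lt _ (by omega))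
  have hq : q ≤ n := by
    by_contra h
    refine hba ?_
    ext1 X
    exact DoubleForm.alt_eq_zero_of_lt _ (by omega)
  have hC := DoubleForm.extConst_ne_zero (p := p) hmq.1 hmq.2 hrm
  set b := fun a => DoubleForm.wedge₂ (DoubleForm.sigma (n + 1)) p q (c a) with hbdef
  have hb : ∀ (i : Fin (n + 1)) (u : Fin (n + 1) → ℝ), u i = 0 →
      DoubleForm.pullSq (DoubleForm.homForm r b) u = 0 := by
    intro i u hu
    have h := DoubleForm.wedge₂_nu_eq_zero htrace hc i u hu
    rw [DoubleForm.wedge₂_nu, smul_eq_zero_iff_right (by norm_num)] at h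
    simp only [DoubleForm.map_homForm] at h
    exact h
  have hmem : DoubleForm.homForm r (DoubleForm.extCoeff r m b) ∈ DoubleForm.HomForm n p q r m :=
    DoubleForm.homForm_mem_homForm _ fun a ha => DoubleForm.extCoeff_mem_summand hmq.1 (hcm a ha)
  have hpoly := DoubleForm.mem_polyForm_of_homForm hmem
  refine ⟨hC, DoubleForm.homForm r (DoubleForm.extCoeff r m b), ⟨hmem, ?_⟩, ?_, ?_⟩
  · refine DoubleForm.traceFree_of_pullSq hpoly fun i u hu => ?_
    -- The pullback of the extension is `u_N` times a form, so it vanishes on every hyperplane `uᵢ =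
    -- 0`.
    obtain ⟨k, h, d, -, h2⟩ := DoubleForm.exists_quotient b hb
    rw [DoubleForm.pullSq_extCoeff, ← h2, Finset.prod_eq_zero (Finset.mem_univ i) hu, zero_smul,
      smul_zero]
  · refine hc.of_wedge₂_eq fun x _ => ?_
    rw [DoubleForm.map_homForm, DoubleForm.map_homForm]
    refine congrFun (DoubleForm.homForm_congr fun a ha => ?_) x
    exact DoubleForm.wedge₂_extCoeff hmq.1 hC ha (hcm a ha)
  · intro φ hφ hφext
    obtain ⟨c', hc'⟩ := DoubleForm.exists_homForm (r := r) id φ fun f g => hφ.1 _ _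
    have hφc : φ = DoubleForm.homForm r c' := funext hc'
    refine DoubleForm.isExtensionFormula hp hq b hb ?_ hpoly
    funext x
    rw [hφc, DoubleForm.map_homForm]
    refine congrFun (DoubleForm.homForm_congr fun a ha => ?_) x
    -- Any two extensions have the same product with `dσ` on the simplex. By homogeneity its
    -- coefficients are those of `b`, so the formula gives the same result for each extension.
    refine DoubleForm.homForm_unique (r := r)
      (fun a => DoubleForm.wedge₂ (DoubleForm.sigma (n + 1)) p q (c' a)) b (fun x hx => ?_) ha
    have h := hφext.wedge₂_eq hc hx
    rw [hφc, DoubleForm.map_homForm, DoubleForm.map_homForm] at h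
    exact h
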